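/- Let $\Bbbk$ be a field of characteristic $0$. CDGAs are non-negatively graded, DG modules are $\mathbb Z$-graded, and differentials have degree $+1$. For a graded space $V$, $\Lambda V$ is the free graded commutative algebra on $V$, $\Lambda^pV$ is its part of wordlength $p$, and $\Lambda^{\ge p}V=\bigoplus_{i\ge p}\Lambda^iV$. Let $(\Lambda V,d)=\Lambda Z\otimes\Lambda W$, with $V=Z\oplus W$, be a relative Sullivan algebra. That is: the base $\Lambda Z$ is a sub-CDGA with $H^0(\Lambda Z)=\Bbbk$, $Z=Z^{\ge 0}$ is the union of subspaces $0=Z(-1)\subset Z(0)\subset Z(1)\subset\cdots$ with $dZ(k)\subset\Lambda Z(k-1)$, and $W=W^{\ge 1}$ is the union of subspaces $0=W(-1)\subset W(0)\subset W(1)\subset\cdots$ with $dW(k)\subset(\Bbbk\oplus(\Lambda Z)^{\ge 1})\otimes\Lambda W(k-1)$. Let $(\Lambda W,\bar d)=\Lambda V/(Z)$ be the fibre. A DG $\Lambda V$-module $P$ is semifree if it is the union of submodules $0=P(-1)\subset P(0)\subset P(1)\subset\cdots$ such that each $P(k)/P(k-1)$ is a free $\Lambda V$-module on a graded space of cocycles.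 For $\Lambda L$ one of $\Lambda V,\Lambda Z,\Lambda W$ and a (semifree) DG $\Lambda L$-module $M$, the Toomer invariant $e_{\Lambda L}(M)$ is the least integer $r\ge 0$ such that the projection $M\to M/(\Lambda^{>r}L\cdot M)$ is injective on cohomology ($\infty$ if there is none). Let $P$ be a semifree $\Lambda V$-module. Put $P^{\ge p,\ge q}=(\Lambda^{\ge p}Z\otimes\Lambda^{\ge q}W)\cdot P$ and $P^{p,\ge q}=P^{\ge p,\ge q}/P^{\ge p+1,\ge q}$. By freeness $P^{p,\ge q}=(P^{\ge p,\ge q}+P^{\ge p+1,\ge 0})/P^{\ge p+1,\ge 0}$. Here numerator and denominator are stable under $d$, and $\Lambda^{\ge1}Z$ acts trivially on the quotient, so that $P^{p,\ge q}$ is a DG module over $(\Lambda W,\bar d)$. **Theorem.** Regard $P$ as a $\Lambda Z$-module by restriction. Suppose that $m,n\ge 0$ are integers with $e_{\Lambda Z}(P)=m$ and $e_{\Lambda W}(P^{p,\ge q})\le n$ for all $p,q\ge 0$. Then $$e_{\Lambda V}(P)\le (m+1)(n+2)-2 .$$ If moreover $\Lambda V$ is a minimal Sullivan algebra (that is, also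 $V=V^{\ge 1}$ and $dV^i\subset\Lambda V^{\le i}$ for all $i$), then $$e_{\Lambda V}(P)\le (m+1)(n+1)-1 .$$ -/

import Mathlib

open scoped DirectSum

namespace RelToomer

universe u v w

/-! ### Commutative differential graded algebras and free graded commutative algebras -/

/-- A structure of commutative differential graded algebra (CDGA), non-negatively graded with
differential of degree `+1`, on the `k`-algebra `A`. -/
structure CDGA (k : Type u) (A : Type v) [Field k] [Ring A] [Algebra k A] where
  /-- the homogeneous components -/
  gr : ℕ → Submodule k A
  /-- `A` is the direct sum of the `gr n`, and the grading is multiplicative -/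
  graded : GradedAlgebra gr
  /-- the differential -/
  d : A →ₗ[k] A
  gcomm : ∀ i j : ℕ, ∀ a ∈ gr i, ∀ b ∈ gr j, a * b = (-1) ^ (i * j) * (b * a)
  d_mem : ∀ n : ℕ, ∀ a ∈ gr n, d a ∈ gr (n + 1)
  d_d : ∀ a, d (d a) = 0
  leibniz : ∀ n : ℕ, ∀ a ∈ gr n, ∀ b, d (a * b) = d a * b + (-1) ^ n * (a * d b)

/-- The relations `x y = (-1)^{|x||y|} y x` in the tensor algebra of a graded vector space. -/
inductive FreeRel (k : Type u) [Field k] (V : ℕ → Type v) [∀ n, AddCommGroup (V n)]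
    [∀ n, Module k (V n)] : TensorAlgebra k (⨁ n, V n) → TensorAlgebra k (⨁ n, V n) → Prop
  | swap (i j : ℕ) (x : V i) (y : V j) : FreeRel k V
      (TensorAlgebra.ι k (DirectSum.lof k ℕ V i x) * TensorAlgebra.ι k (DirectSum.lof k ℕ V j y))
      ((-1) ^ (i * j) *
        (TensorAlgebra.ι k (DirectSum.lof k ℕ V j y) *
          TensorAlgebra.ι k (DirectSum.lof k ℕ V i x)))

/-- The free graded commutative algebra `ΛV` on a graded vector space `V` (over a field of
characteristic `0`; there the relations give `x ^ 2 = 0` for `x` of odd degree). -/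
abbrev FreeGCA (k : Type u) [Field k] (V : ℕ → Type v) [∀ n, AddCommGroup (V n)]
    [∀ n, Module k (V n)] : Type (max u v) :=
  RingQuot (FreeRel k V)

section Algebra

variable {k : Type u} {A : Type v} [Field k] [Ring A] [Algebra k A]

/-- The total space `⨁ V^n ⊆ A` of a family of homogeneous subspaces. -/
def total (V : ℕ → Submodule k A) : Submodule k A := ⨆ n, V n

/-- The map `TV → A` induced by the inclusion of a graded subspace `V`. -/
noncomputable def tensorMap (V : ℕ → Submodule k A) :
    TensorAlgebra k (⨁ n, V n) →ₐ[k] A :=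
  TensorAlgebra.lift k (DirectSum.toModule k ℕ A fun n => (V n).subtype)

namespace CDGA

variable (C : CDGA k A)

/-- The canonical algebra homomorphism `ΛV → A` extending the inclusion of a graded subspace
`V` of `A`. -/
noncomputable def canonicalMap (V : ℕ → Submodule k A) (hV : ∀ n, V n ≤ C.gr n) :
    FreeGCA k (fun n => V n) →ₐ[k] A :=
  RingQuot.liftAlgHom k ⟨tensorMap V, by
    rintro _ _ ⟨i, j, x, y⟩
    simpa [tensorMap] using C.gcomm i j x (hV i x.2) y (hV j y.2)⟩

/-- The underlying graded algebra of `A` is the free graded commutative algebra `ΛV` on the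
graded subspace `V`. -/
def IsFreeOn (V : ℕ → Submodule k A) : Prop :=
  ∃ hV : ∀ n, V n ≤ C.gr n, Function.Bijective (C.canonicalMap V hV)

/-- The Sullivan condition: `V` is the union of subspaces
`0 = V(-1) ⊆ V(0) ⊆ V(1) ⊆ ⋯` with `d V(k) ⊆ Λ V(k-1)`. Here `F j` is `V(j-1)`. -/
def SullivanCondition (V : ℕ → Submodule k A) : Prop :=
  ∃ F : ℕ → Submodule k A, F 0 = ⊥ ∧ Monotone F ∧ (⨆ j, F j) = total V ∧
    ∀ j, ∀ x ∈ F (j + 1), C.d x ∈ Algebra.adjoin k (F j : Set A)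

/-- `(A, d) = ΛV` is a minimal Sullivan algebra: `V` is concentrated in positive degrees, the
Sullivan condition holds, and `d V^n ⊆ Λ V^{≤ n}`. -/
structure IsMinimalSullivan (V : ℕ → Submodule k A) : Prop where
  free : C.IsFreeOn V
  pos : V 0 = ⊥
  sullivan : C.SullivanCondition V
  minimal : ∀ n, ∀ x ∈ V n, C.d x ∈ Algebra.adjoin k (⋃ i ≤ n, (V i : Set A))

/-- The subspace `(ΛZ)^{≥ 1}` of elements of positive degree of the subalgebra generated
by `Z`. -/
def basePos (Z : ℕ → Submodule k A) : Submodule k A :=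
  ⨆ n : ℕ, Subalgebra.toSubmodule (Algebra.adjoin k (total Z : Set A)) ⊓ C.gr (n + 1)

/-- `(A, d) = ΛV = ΛZ ⊗ ΛW` is a relative Sullivan algebra with base the connected
KS complex `ΛZ` and with fibre `ΛW`. -/
structure IsRelativeSullivan (Z W : ℕ → Submodule k A) : Prop where
  disjoint : ∀ n, Disjoint (Z n) (W n)
  /-- as a graded algebra, `A = ΛV` with `V = Z ⊕ W` -/
  free : C.IsFreeOn fun n => Z n ⊔ W n
  /-- the base `ΛZ` is a KS complex; in particular it is stable under `d` -/
  base_sullivan : C.SullivanCondition Z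
  /-- the base is connected: `H^0(ΛZ) = k` -/
  base_connected : ∀ x ∈ Algebra.adjoin k (total Z : Set A), x ∈ C.gr 0 → C.d x = 0 →
    x ∈ (1 : Submodule k A)
  /-- `W` is concentrated in positive degrees -/
  fibre_pos : W 0 = ⊥
  /-- `W` is the union of subspaces `0 = W(-1) ⊆ W(0) ⊆ ⋯` with
  `d W(k) ⊆ (k ⊕ (ΛZ)^{≥ 1}) ⊗ Λ W(k-1)`. Here `F j` is `W(j-1)`. -/
  fibre_sullivan : ∃ F : ℕ → Submodule k A, F 0 = ⊥ ∧ Monotone F ∧ (⨆ j, F j) = total W ∧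
    ∀ j, ∀ x ∈ F (j + 1), C.d x ∈
      (1 ⊔ C.basePos Z) * Subalgebra.toSubmodule (Algebra.adjoin k (F j : Set A))

end CDGA

end Algebra

/-! ### Differential graded modules -/

/-- A structure of `ℤ`-graded differential graded module over the CDGA `A` on the
`A`-module `P`. -/
structure DGModule {k : Type u} {A : Type v} [Field k] [Ring A] [Algebra k A] (C : CDGA k A)
    (P : Type w) [AddCommGroup P] [Module k P] [Module A P] [IsScalarTower k A P] where
  /-- the homogeneous components -/
  gr : ℤ → Submodule k P
  isInternal : DirectSum.IsInternal gr
  smul_mem : ∀ (n : ℕ) (i : ℤ), ∀ a ∈ C.gr n, ∀ x ∈ gr i, a • x ∈ gr (n + i)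
  /-- the differential -/
  d : P →ₗ[k] P
  d_mem : ∀ i : ℤ, ∀ x ∈ gr i, d x ∈ gr (i + 1)
  d_d : ∀ x, d (d x) = 0
  leibniz : ∀ n : ℕ, ∀ a ∈ C.gr n, ∀ x, d (a • x) = C.d a • x + (-1 : A) ^ n • (a • d x)

/-- `P` is semifree: it is the union of an increasing sequence of submodules
`0 = P(-1) ⊆ P(0) ⊆ P(1) ⊆ ⋯` such that every `P(k) / P(k-1)` is a free DG module `A ⊗ U`
with `d U = 0`, that is, it is a free `A`-module on classes of homogeneous elements `b` with
`d b ∈ P(k-1)`. Here `F j` is `P(j-1)`. -/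
def DGModule.IsSemifree {k : Type u} {A : Type v} [Field k] [Ring A] [Algebra k A]
    {C : CDGA k A} {P : Type w} [AddCommGroup P] [Module k P] [Module A P] [IsScalarTower k A P]
    (D : DGModule C P) : Prop :=
  ∃ F : ℕ → Submodule A P, F 0 = ⊥ ∧ Monotone F ∧ (⨆ j, F j) = ⊤ ∧
    ∀ j, ∃ S : Set P,
      (∀ b ∈ S, (∃ i, b ∈ D.gr i) ∧ D.d b ∈ F j) ∧
      LinearIndependent A (fun b : S => (F j).mkQ b) ∧
      F (j + 1) = F j ⊔ Submodule.span A S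

/-! ### Cohomology and the Toomer invariant -/

section Cohomology

variable {k : Type u} [Field k] {M : Type v} {N : Type w} [AddCommGroup M] [Module k M]
  [AddCommGroup N] [Module k N]

/-- The cohomology `ker d / im d` of a vector space with differential (the direct sum of the
cohomology spaces of all degrees, if there is a grading). -/
abbrev Cohomology (d : M →ₗ[k] M) : Type v :=
  LinearMap.ker d ⧸ (LinearMap.range d).submoduleOf (LinearMap.ker d)

/-- The map induced on cohomology by a linear map that commutes with the differentials. -/
noncomputable def cohomologyMap (d : M →ₗ[k] M) (d' : N →ₗ[k] N) (f : M →ₗ[k] N)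
    (hf : ∀ x, f (d x) = d' (f x)) : Cohomology d →ₗ[k] Cohomology d' :=
  Submodule.mapQ _ _
    (f.restrict (p := LinearMap.ker d) (q := LinearMap.ker d') fun x hx => by
      rw [LinearMap.mem_ker] at hx ⊢
      rw [← hf, hx, map_zero])
    (by
      rintro ⟨x, hx⟩ ⟨y, hy⟩
      exact ⟨f y, by rw [← hf, hy]; rfl⟩)

/-- `L` is stable under `d` and the projection `M → M / L` is injective on cohomology. -/
def ProjectionInjective (d : M →ₗ[k] M) (L : Submodule k M) : Prop :=
  ∃ h : L ≤ L.comap d,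
    Function.Injective (cohomologyMap d (L.mapQ L d h) L.mkQ fun _ => rfl)

/-- The Toomer invariant `e_{ΛV}(M)` of a (semifree) DG module with differential `d` over a
connected KS complex `ΛV`: the least `m` such that the projection `M → M / (Λ^{> m} V · M)` is
injective on cohomology, and `⊤` if there is none. The space `V` of generators is given as a
subspace of an algebra `A` acting on `M`, so that `Λ^{> m} V · M = V ^ (m + 1) · M`; only the action
of the subalgebra generated by `V` matters. -/
noncomputable def toomer {A : Type*} [Ring A] [Algebra k A] [Module A M] [IsScalarTower k A M]
    (V : Submodule k A) (d : M →ₗ[k] M) : ℕ∞ :=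
  ⨅ (m : ℕ) (_ : ProjectionInjective d (V ^ (m + 1) • (⊤ : Submodule k M))), (m : ℕ∞)

end Cohomology


/-! ### The bigraded filtration quotients

The helper facts below only serve to show that the submodules `P^{≥ p, ≥ q} + P^{≥ p+1, ≥ 0}`
are stable under the differential. -/

namespace CDGA

variable {k : Type u} {A : Type v} [Field k] [Ring A] [Algebra k A] (C : CDGA k A)

theorem induction {p : A → Prop} (h0 : p 0) (hadd : ∀ a b, p a → p b → p (a + b))
    (hom : ∀ n, ∀ a ∈ C.gr n, p a) (a : A) : p a := by
  let _ := C.graded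
  exact DirectSum.Decomposition.inductionOn C.gr h0 (fun m => hom _ m m.2) hadd a

/-- The sign involution `a ↦ (-1)^{|a|} a`. -/
theorem exists_sign : ∃ σ : A →ₗ[k] A, (∀ n, ∀ a ∈ C.gr n, σ a = (-1) ^ n * a) ∧
    (∀ a b, σ (a * b) = σ a * σ b) ∧ ∀ a b, C.d (a * b) = C.d a * b + σ a * C.d b := by
  let _ := C.graded
  let s : (⨁ n, C.gr n) →ₗ[k] A :=
    DirectSum.toModule k ℕ A fun n => (LinearMap.mulLeft k ((-1 : A) ^ n)) ∘ₗ (C.gr n).subtype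
  let σ : A →ₗ[k] A := s ∘ₗ (DirectSum.decomposeLinearEquiv C.gr).toLinearMap
  have hσ : ∀ n, ∀ a ∈ C.gr n, σ a = (-1) ^ n * a := by
    intro n a ha
    simp only [σ, s, LinearMap.comp_apply, LinearEquiv.coe_coe,
      DirectSum.decomposeLinearEquiv_apply]
    rw [DirectSum.decompose_of_mem C.gr ha]
    erw [DirectSum.toModule_lof]
    simp
  refine ⟨σ, hσ, ?_, ?_⟩
  · intro a b
    induction a using C.induction with
    | h0 => simp
    | hadd a a' h h' => simp only [add_mul, map_add, h, h']
    | hom n a ha =>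
      induction b using C.induction with
      | h0 => simp
      | hadd b b' h h' => simp only [mul_add, map_add, h, h']
      | hom m b hb =>
        rw [hσ n a ha, hσ m b hb, hσ (n + m) (a * b) (SetLike.GradedMul.mul_mem ha hb), pow_add]
        have hc : Commute ((-1 : A) ^ m) a := (Commute.neg_one_left a).pow_left m
        rw [mul_assoc, mul_assoc, ← mul_assoc _ a b, hc.eq, mul_assoc a]
  · intro a b
    induction a using C.induction with
    | h0 => simp
    | hadd a a' h h' => simp only [add_mul, map_add, h, h']; abel
    | hom n a ha => rw [C.leibniz n a ha, hσ n a ha, mul_assoc]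

/-- A graded subspace generates the same left and right ideal. -/
theorem top_mul_total (V : ℕ → Submodule k A) (hV : ∀ n, V n ≤ C.gr n) :
    (⊤ : Submodule k A) * total V = total V * ⊤ := by
  have hs : ∀ n : ℕ, ∀ (S : Submodule k A) (a : A), a ∈ S → (-1) ^ n * a ∈ S := by
    intro n S a ha
    rcases neg_one_pow_eq_or A n with h | h <;> simp [h, ha]
  unfold total
  rw [Submodule.mul_iSup, Submodule.iSup_mul]
  congr 1
  funext n
  apply le_antisymm
  · rw [Submodule.mul_le]
    intro a _ x hx
    induction a using C.induction with
    | h0 => simp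
    | hadd a b ha hb => rw [add_mul]; exact add_mem (ha trivial) (hb trivial)
    | hom m a ha =>
      rw [C.gcomm m n a ha x (hV n hx)]
      exact hs _ _ _ (Submodule.mul_mem_mul hx trivial)
  · rw [Submodule.mul_le]
    intro x hx a _
    induction a using C.induction with
    | h0 => simp
    | hadd a b ha hb => rw [mul_add]; exact add_mem (ha trivial) (hb trivial)
    | hom m a ha =>
      rw [C.gcomm n m x (hV n hx) a ha]
      exact hs _ _ _ (Submodule.mul_mem_mul trivial hx)

/-- An element of positive degree without constant term modulo the ideal generated by `V` lies in
this ideal. -/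
theorem mem_ideal_of_pos (V : ℕ → Submodule k A) (hV : ∀ n, V n ≤ C.gr n) (n : ℕ) (x : A)
    (hx : x ∈ C.gr (n + 1)) (h : x ∈ (1 : Submodule k A) ⊔ ⊤ * total V) :
    x ∈ (⊤ : Submodule k A) * total V := by
  let _ := C.graded
  obtain ⟨c, hc, y, hy, rfl⟩ := Submodule.mem_sup.mp h
  have key : ∀ y ∈ (⊤ : Submodule k A) * total V, ∀ i,
      ((DirectSum.decompose C.gr y i : C.gr i) : A) ∈ (⊤ : Submodule k A) * total V := by
    intro y hy i
    unfold total at hy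
    rw [Submodule.mul_iSup] at hy
    induction hy using Submodule.iSup_induction' with
    | zero => simp
    | add a b _ _ ha hb =>
      rw [DirectSum.decompose_add, DirectSum.add_apply]
      exact add_mem ha hb
    | mem j y hy =>
      induction hy using Submodule.mul_induction_on' with
      | add a _ b _ ha hb =>
        rw [DirectSum.decompose_add, DirectSum.add_apply]
        exact add_mem ha hb
      | mem_mul_mem a _ z hz =>
        have hz' : z ∈ total V := (le_iSup V j) hz
        by_cases hji : j ≤ i
        · rw [DirectSum.coe_decompose_mul_of_right_mem_of_le C.gr (hV j hz) hji]
          exact Submodule.mul_mem_mul trivial hz'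
        · rw [DirectSum.coe_decompose_mul_of_right_mem_of_not_le C.gr (hV j hz) hji]
          exact zero_mem _
  have h1 := DirectSum.decompose_of_mem_same C.gr hx
  have hc0 : c ∈ C.gr 0 := by
    obtain ⟨r, rfl⟩ := Submodule.mem_one.mp hc
    exact SetLike.algebraMap_mem_graded C.gr r
  rw [DirectSum.decompose_add, DirectSum.add_apply, Submodule.coe_add,
    DirectSum.decompose_of_mem_ne C.gr hc0 (by omega), zero_add] at h1
  rw [← h1]
  exact key y hy _

theorem adjoin_le_sup (V : ℕ → Submodule k A)
    (S : Submodule k A) (hS : S ≤ total V) :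
    Subalgebra.toSubmodule (Algebra.adjoin k (S : Set A)) ≤ 1 ⊔ ⊤ * total V := by
  have ht : total V ≤ ⊤ * total V := fun x hx => by
    simpa using Submodule.mul_mem_mul (Submodule.mem_top : (1 : A) ∈ (⊤ : Submodule k A)) hx
  have hI : (⊤ * total V) * (⊤ * total V) ≤ (⊤ : Submodule k A) * total V := by
    rw [← mul_assoc]
    exact mul_le_mul' le_top le_rfl
  intro x hx
  rw [Subalgebra.mem_toSubmodule] at hx
  induction hx using Algebra.adjoin_induction with
  | mem x hx => exact Submodule.mem_sup_right (ht (hS hx))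
  | algebraMap r => exact Submodule.mem_sup_left (Submodule.mem_one.mpr ⟨r, rfl⟩)
  | add x y _ _ h h' => exact add_mem h h'
  | mul x y _ _ h h' =>
    have h2 := Submodule.mul_mem_mul h h'
    refine (?_ : ((1 : Submodule k A) ⊔ ⊤ * total V) * (1 ⊔ ⊤ * total V) ≤ _) h2
    rw [Submodule.sup_mul, one_mul, Submodule.mul_sup, mul_one]
    exact sup_le le_rfl (sup_le le_sup_right (hI.trans le_sup_right))

namespace IsRelativeSullivan

variable {C} {Z W : ℕ → Submodule k A}

theorem le_gr (h : C.IsRelativeSullivan Z W) (n : ℕ) : Z n ⊔ W n ≤ C.gr n := h.free.1 n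

theorem total_sup (Z W : ℕ → Submodule k A) :
    total (fun n => Z n ⊔ W n) = total Z ⊔ total W := iSup_sup_eq

theorem d_total (V : ℕ → Submodule k A) (hV : ∀ n, V n ≤ C.gr n) (I : Submodule k A)
    (H : ∀ n, ∀ x ∈ V n, C.d x ∈ C.gr (n + 1) → C.d x ∈ I) : ∀ x ∈ total V, C.d x ∈ I := by
  intro x hx
  induction hx using Submodule.iSup_induction' with
  | zero => simp
  | add a b _ _ ha hb => rw [map_add]; exact add_mem ha hb
  | mem n x hx => exact H n x hx (C.d_mem n x (hV n hx))

theorem d_base (h : C.IsRelativeSullivan Z W) : ∀ x ∈ total Z, C.d x ∈ ⊤ * total Z := by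
  have hZ : ∀ n, Z n ≤ C.gr n := fun n => le_sup_left.trans (h.le_gr n)
  obtain ⟨F, hF0, hF, hFV, hd⟩ := h.base_sullivan
  refine d_total Z hZ _ fun n x hx hdx => C.mem_ideal_of_pos Z hZ n _ hdx ?_
  have hx' : x ∈ ⨆ j, F j := hFV ▸ (le_iSup Z n) hx
  obtain ⟨j, hj⟩ := (Submodule.mem_iSup_of_directed F hF.directed_le).mp hx'
  exact adjoin_le_sup Z (F j) (hFV ▸ le_iSup F j) (hd j x (hF (Nat.le_succ j) hj))

theorem d_fibre (h : C.IsRelativeSullivan Z W) :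
    ∀ x ∈ total W, C.d x ∈ ⊤ * total W ⊔ ⊤ * total Z := by
  have hZ : ∀ n, Z n ≤ C.gr n := fun n => le_sup_left.trans (h.le_gr n)
  have hW : ∀ n, W n ≤ C.gr n := fun n => le_sup_right.trans (h.le_gr n)
  have hb : C.basePos Z ≤ ⊤ * total Z := by
    refine iSup_le fun n x hx => ?_
    exact C.mem_ideal_of_pos Z hZ n x hx.2 (adjoin_le_sup Z _ le_rfl hx.1)
  obtain ⟨F, hF0, hF, hFV, hd⟩ := h.fibre_sullivan
  refine d_total W hW _ fun n x hx hdx => ?_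
  have hVsup : (⊤ : Submodule k A) * total (fun n => Z n ⊔ W n) =
      ⊤ * total W ⊔ ⊤ * total Z := by
    rw [total_sup, Submodule.mul_sup, sup_comm]
  rw [← hVsup]
  refine C.mem_ideal_of_pos _ h.le_gr n _ hdx ?_
  rw [hVsup]
  have hx' : x ∈ ⨆ j, F j := hFV ▸ (le_iSup W n) hx
  obtain ⟨j, hj⟩ := (Submodule.mem_iSup_of_directed F hF.directed_le).mp hx'
  have h1 := hd j x (hF (Nat.le_succ j) hj)
  have h2 := adjoin_le_sup W (F j) (hFV ▸ le_iSup F j)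
  have h3 : (1 ⊔ C.basePos Z) * Subalgebra.toSubmodule (Algebra.adjoin k (F j : Set A)) ≤
      (1 ⊔ ⊤ * total Z) * (1 ⊔ ⊤ * total W) := mul_le_mul' (sup_le_sup_left hb _) h2
  refine (?_ : ((1 : Submodule k A) ⊔ ⊤ * total Z) * (1 ⊔ ⊤ * total W) ≤ _) (h3 h1)
  rw [Submodule.sup_mul, one_mul]
  refine sup_le (sup_le_sup_left le_sup_left _) ?_
  calc (⊤ * total Z) * (1 ⊔ ⊤ * total W) ≤ (⊤ * total Z) * ⊤ := mul_le_mul' le_rfl le_top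
    _ ≤ ⊤ * total Z := by
      rw [mul_assoc, ← C.top_mul_total Z hZ, ← mul_assoc]
      exact mul_le_mul' le_top le_rfl
    _ ≤ _ := le_sup_right.trans le_sup_right

/-- `d (Λ^p Z · Λ^q W) ⊆ A · Λ^p Z · Λ^q W + A · Λ^{p+1} Z`. -/
theorem d_bigraded (h : C.IsRelativeSullivan Z W) (p q : ℕ) :
    ∃ σ : A →ₗ[k] A, (∀ n, ∀ a ∈ C.gr n, σ a = (-1) ^ n * a) ∧
      ∀ x ∈ total Z ^ p * total W ^ q, σ x ∈ total Z ^ p * total W ^ q ∧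
        C.d x ∈ ⊤ * (total Z ^ p * total W ^ q) ⊔ ⊤ * total Z ^ (p + 1) := by
  obtain ⟨σ, hσ, hσm, hL⟩ := C.exists_sign
  have hZ : ∀ n, Z n ≤ C.gr n := fun n => le_sup_left.trans (h.le_gr n)
  have hW : ∀ n, W n ≤ C.gr n := fun n => le_sup_right.trans (h.le_gr n)
  have cZ := C.top_mul_total Z hZ
  have cW := C.top_mul_total W hW
  have hT : (⊤ : Submodule k A) * ⊤ ≤ ⊤ := le_top
  have hs : ∀ V : ℕ → Submodule k A, (∀ n, V n ≤ C.gr n) → ∀ x ∈ total V, σ x ∈ total V := by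
    intro V hV x hx
    induction hx using Submodule.iSup_induction' with
    | zero => simp
    | add a b _ _ ha hb => rw [map_add]; exact add_mem ha hb
    | mem n x hx =>
      have hx' : x ∈ total V := le_iSup V n hx
      rw [hσ n x (hV n hx)]
      rcases neg_one_pow_eq_or A n with h | h <;> simp [h, hx']
  have hσ1 : σ 1 = 1 := by
    let _ := C.graded
    simpa using hσ 0 1 SetLike.GradedOne.one_mem
  have hd1 : C.d 1 = 0 := by
    have := hL 1 1
    rw [hσ1] at this
    simpa using this
  have hd1' : ∀ x ∈ (1 : Submodule k A), C.d x = 0 := by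
    intro x hx
    obtain ⟨r, rfl⟩ := Submodule.mem_one.mp hx
    rw [Algebra.algebraMap_eq_smul_one, map_smul, hd1, smul_zero]
  -- the Leibniz rule for products of subspaces
  have prod : ∀ S T I J K : Submodule k A, (∀ x ∈ S, σ x ∈ S) → (∀ x ∈ S, C.d x ∈ I) →
      (∀ x ∈ T, C.d x ∈ J) → I * T ≤ K → S * J ≤ K → ∀ x ∈ S * T, C.d x ∈ K := by
    intro S T I J K h1 h2 h3 h4 h5 x hx
    induction hx using Submodule.mul_induction_on' with
    | add a _ b _ ha hb => rw [map_add]; exact add_mem ha hb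
    | mem_mul_mem a ha b hb =>
      rw [hL]
      exact add_mem (h4 (Submodule.mul_mem_mul (h2 a ha) hb))
        (h5 (Submodule.mul_mem_mul (h1 a ha) (h3 b hb)))
  have hsp : ∀ V : ℕ → Submodule k A, (∀ n, V n ≤ C.gr n) → ∀ p, ∀ x ∈ total V ^ p,
      σ x ∈ total V ^ p := by
    intro V hV p
    induction p with
    | zero =>
      intro x hx
      rw [pow_zero] at hx ⊢
      obtain ⟨r, rfl⟩ := Submodule.mem_one.mp hx
      rw [Algebra.algebraMap_eq_smul_one, map_smul, hσ1, ← Algebra.algebraMap_eq_smul_one]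
      exact Submodule.mem_one.mpr ⟨r, rfl⟩
    | succ p ih =>
      intro x hx
      rw [pow_succ] at hx ⊢
      induction hx using Submodule.mul_induction_on' with
      | add a _ b _ ha hb => rw [map_add]; exact add_mem ha hb
      | mem_mul_mem a ha b hb =>
        rw [hσm]
        exact Submodule.mul_mem_mul (ih a ha) (hs V hV b hb)
  have hdZ : ∀ p, ∀ x ∈ total Z ^ p, C.d x ∈ ⊤ * total Z ^ p := by
    intro p
    induction p with
    | zero =>
      intro x hx
      rw [pow_zero] at hx
      simp [hd1' x hx]
    | succ p ih =>
      intro x hx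
      rw [pow_succ'] at hx
      refine prod _ _ _ _ _ (hs Z hZ) h.d_base ih ?_ ?_ x hx
      · rw [pow_succ', mul_assoc]
      · rw [← mul_assoc, ← cZ, mul_assoc, pow_succ']
  have hdW : ∀ q, ∀ x ∈ total W ^ q, C.d x ∈ ⊤ * total W ^ q ⊔ ⊤ * total Z := by
    intro q
    have hr : ∀ S : Submodule k A, (⊤ * total Z) * S ≤ ⊤ * total Z := by
      intro S
      calc (⊤ * total Z) * S ≤ (⊤ * total Z) * ⊤ := mul_le_mul' le_rfl le_top
        _ = (⊤ * ⊤) * total Z := by rw [mul_assoc, ← cZ, mul_assoc]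
        _ ≤ ⊤ * total Z := mul_le_mul' le_top le_rfl
    have hl : ∀ S : Submodule k A, S * (⊤ * total Z) ≤ ⊤ * total Z := by
      intro S
      rw [← mul_assoc]
      exact mul_le_mul' le_top le_rfl
    induction q with
    | zero =>
      intro x hx
      rw [pow_zero] at hx
      simp [hd1' x hx]
    | succ q ih =>
      intro x hx
      rw [pow_succ'] at hx
      refine prod _ _ _ _ _ (hs W hW) h.d_fibre ih ?_ ?_ x hx
      · rw [Submodule.sup_mul, pow_succ', mul_assoc]
        exact sup_le_sup le_rfl (hr _)
      · rw [Submodule.mul_sup, ← mul_assoc, ← cW, mul_assoc, pow_succ']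
        exact sup_le_sup le_rfl (hl _)
  refine ⟨σ, hσ, fun x hx => ⟨?_, prod _ _ _ _ _ (hsp Z hZ p) (hdZ p) (hdW q) ?_ ?_ x hx⟩⟩
  · induction hx using Submodule.mul_induction_on' with
    | add a _ b _ ha hb => rw [map_add]; exact add_mem ha hb
    | mem_mul_mem a ha b hb =>
      rw [hσm]
      exact Submodule.mul_mem_mul (hsp Z hZ p a ha) (hsp W hW q b hb)
  · rw [mul_assoc]
    exact le_sup_left
  · have hc : total Z ^ p * ⊤ = ⊤ * total Z ^ p :=
      ((Commute.pow_left (show Commute (total Z) ⊤ from cZ.symm) p)).eq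
    rw [Submodule.mul_sup, ← mul_assoc, ← mul_assoc, hc, mul_assoc, mul_assoc, pow_succ]

end IsRelativeSullivan

end CDGA

section Bigraded

variable {k : Type u} {A : Type v} [Field k] [Ring A] [Algebra k A] {C : CDGA k A}
  {P : Type w} [AddCommGroup P] [Module k P] [Module A P] [IsScalarTower k A P]

/-- The submodule `P^{≥ p, ≥ q} = (Λ^p Z ⊗ Λ^q W) · P = (Λ^{≥ p} Z ⊗ Λ^{≥ q} W) · P` of `P`. -/
def bigradedSub (P : Type w) [AddCommGroup P] [Module k P] [Module A P] [IsScalarTower k A P]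
    (Z W : ℕ → Submodule k A) (p q : ℕ) : Submodule A P :=
  Submodule.span A ((total Z ^ p * total W ^ q) • (⊤ : Submodule k P) : Submodule k P)

/-- The submodule `P^{≥ p, ≥ q} + P^{≥ p+1, ≥ 0}` of `P`. -/
def bigradedSum (P : Type w) [AddCommGroup P] [Module k P] [Module A P] [IsScalarTower k A P]
    (Z W : ℕ → Submodule k A) (p q : ℕ) : Submodule A P :=
  bigradedSub P Z W p q ⊔ bigradedSub P Z W (p + 1) 0

theorem d_mem_bigradedSub (D : DGModule C P) {Z W : ℕ → Submodule k A}
    (h : C.IsRelativeSullivan Z W) (p q : ℕ) :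
    ∀ x ∈ bigradedSub P Z W p q, D.d x ∈ bigradedSum P Z W p q := by
  obtain ⟨σ, hσ, hd⟩ := h.d_bigraded p q
  have hL : ∀ (a : A) (x : P), D.d (a • x) = C.d a • x + σ a • D.d x := by
    intro a x
    induction a using C.induction with
    | h0 => simp
    | hadd a a' h h' => simp only [add_smul, map_add, h, h']; abel
    | hom n a ha => rw [D.leibniz n a ha, hσ n a ha, mul_smul]
  have hsub : ∀ p q, ∀ a ∈ (⊤ : Submodule k A) * (total Z ^ p * total W ^ q), ∀ x : P,
      a • x ∈ bigradedSub P Z W p q := by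
    intro p q a ha x
    induction ha using Submodule.mul_induction_on' with
    | add a _ b _ ha hb => rw [add_smul]; exact add_mem ha hb
    | mem_mul_mem a _ b hb =>
      rw [mul_smul]
      exact Submodule.smul_mem _ _ (Submodule.subset_span (Submodule.smul_mem_smul hb trivial))
  intro x hx
  induction hx using Submodule.span_induction with
  | zero => simp
  | add a b _ _ ha hb => rw [map_add]; exact add_mem ha hb
  | smul a y hy ih =>
    rw [hL]
    exact add_mem (Submodule.smul_mem _ _ (Submodule.mem_sup_left hy)) (Submodule.smul_mem _ _ ih)
  | mem x hx =>
    induction hx using Submodule.smul_induction_on' with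
    | add a _ b _ ha hb => rw [map_add]; exact add_mem ha hb
    | smul c hc y _ =>
      rw [hL]
      obtain ⟨h1, h2⟩ := hd c hc
      refine add_mem ?_ (Submodule.mem_sup_left
        (Submodule.subset_span (Submodule.smul_mem_smul h1 trivial)))
      obtain ⟨a, ha, b, hb, hab⟩ := Submodule.mem_sup.mp h2
      rw [← hab, add_smul]
      refine add_mem (Submodule.mem_sup_left (hsub p q a ha y)) (Submodule.mem_sup_right ?_)
      exact hsub (p + 1) 0 b (by simpa using hb) y

theorem bigradedSub_anti (Z W : ℕ → Submodule k A) (p : ℕ) :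
    bigradedSub P Z W (p + 1) 0 ≤ bigradedSub P Z W p 0 := by
  refine Submodule.span_le.mpr fun x hx => ?_
  simp only [pow_zero, mul_one, SetLike.mem_coe] at hx
  induction hx using Submodule.smul_induction_on' with
  | add a _ b _ ha hb => exact add_mem ha hb
  | smul c hc y _ =>
    rw [pow_succ] at hc
    induction hc using Submodule.mul_induction_on' with
    | add a _ b _ ha hb => rw [add_smul]; exact add_mem ha hb
    | mem_mul_mem a ha b _ =>
      rw [mul_smul]
      exact Submodule.subset_span (Submodule.smul_mem_smul (by simpa using ha) trivial)

theorem d_mem_base (D : DGModule C P) {Z W : ℕ → Submodule k A}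
    (h : C.IsRelativeSullivan Z W) (p : ℕ) :
    ∀ x ∈ bigradedSub P Z W p 0, D.d x ∈ bigradedSub P Z W p 0 := fun x hx =>
  (sup_le le_rfl (bigradedSub_anti Z W p) : bigradedSum P Z W p 0 ≤ _)
    (d_mem_bigradedSub D h p 0 x hx)

theorem d_mem_bigradedSum (D : DGModule C P) {Z W : ℕ → Submodule k A}
    (h : C.IsRelativeSullivan Z W) (p q : ℕ) :
    ∀ x ∈ bigradedSum P Z W p q, D.d x ∈ bigradedSum P Z W p q := by
  intro x hx
  obtain ⟨a, ha, b, hb, rfl⟩ := Submodule.mem_sup.mp hx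
  rw [map_add]
  exact add_mem (d_mem_bigradedSub D h p q a ha)
    (Submodule.mem_sup_right (d_mem_base D h (p + 1) b hb))

/-- The quotient `P^{p, ≥ q} = P^{≥ p, ≥ q} / P^{≥ p+1, ≥ q}`, realised as
`(P^{≥ p, ≥ q} + P^{≥ p+1, ≥ 0}) / P^{≥ p+1, ≥ 0}`; these agree since
`P^{≥ p, ≥ q} ∩ P^{≥ p+1, ≥ 0} = P^{≥ p+1, ≥ q}` when `P` is semifree. -/
abbrev BigradedQuotient (P : Type w) [AddCommGroup P] [Module k P] [Module A P]
    [IsScalarTower k A P] (Z W : ℕ → Submodule k A) (p q : ℕ) : Type w :=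
  ↥(bigradedSum P Z W p q) ⧸ (bigradedSub P Z W (p + 1) 0).submoduleOf (bigradedSum P Z W p q)

/-- The restriction of a differential to a stable submodule `X`. -/
def subDiff (d : P →ₗ[k] P) (X : Submodule A P) (hX : ∀ x ∈ X, d x ∈ X) : X →ₗ[k] X where
  toFun x := ⟨d x, hX x x.2⟩
  map_add' x y := Subtype.ext (map_add d (x : P) y)
  map_smul' c x := Subtype.ext (map_smul d c (x : P))

/-- The differential induced on the quotient by a stable submodule `Y`. -/
def quotDiff (d : P →ₗ[k] P) (Y : Submodule A P) (hY : ∀ x ∈ Y, d x ∈ Y) :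
    (P ⧸ Y) →ₗ[k] (P ⧸ Y) :=
  ((Y.restrictScalars k).liftQ (Y.mkQ.restrictScalars k ∘ₗ d) fun x hx =>
    (Submodule.Quotient.mk_eq_zero Y).mpr (hY x hx)) ∘ₗ
    (Submodule.Quotient.restrictScalarsEquiv k Y).symm.toLinearMap

/-- The differential `d̄` of `P^{p, ≥ q}`, induced by the differential of `P`. The algebra `A`
acts on `P^{p, ≥ q}` through `A / (Z) = (ΛW, d̄)`, so this is a DG module over the fibre. -/
def bigradedDiff (D : DGModule C P) {Z W : ℕ → Submodule k A} (h : C.IsRelativeSullivan Z W)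
    (p q : ℕ) : BigradedQuotient P Z W p q →ₗ[k] BigradedQuotient P Z W p q :=
  quotDiff (subDiff D.d (bigradedSum P Z W p q) (d_mem_bigradedSum D h p q))
    ((bigradedSub P Z W (p + 1) 0).submoduleOf (bigradedSum P Z W p q))
    fun x hx => d_mem_base D h (p + 1) x hx

end Bigraded

end RelToomer

/-!
The idea is to push a cocycle of large wordlength up the filtration of `P` by wordlength in `Z`,
until it lies in `Λ^{≥ m+1} Z · P`, where it is a coboundary because `e_{ΛZ}(P) = m`.

Let `x` be a cocycle in the sum of the submodules `P^{≥ j, ≥ r j}` over `j ≥ p`. Its leading term is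
a cocycle in the DG module `P^{p, ≥ q}` over the fibre, where `q = r p - (n + 1)`, and it lies in
`Λ^{> n} W · P^{p, ≥ q}`. As the Toomer invariant of this module is at most `n`, the leading term
is `d y` modulo `P^{≥ p+1, ≥ 0}` for some `y ∈ P^{≥ p, ≥ q}`. Two facts are needed to see that
`x - d y` lies in the sum of the `P^{≥ j, ≥ r j}` over `j > p` (`exists_sub_d_mem_tailSum`).

* The differential removes at most one letter of `W`, and when it does it creates `δ` letters of
  `Z`. Here `δ = 1` in general, and `δ = 2` in the minimal case, since then `d V ⊆ Λ^{≥ 2} V`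
  (`DGModule.d_mem_bigradedSub_sup`, `CDGA.IsMinimalSullivan.d_mem`).
* An element of `P^{≥ p, ≥ q} ∩ P^{≥ p+1, ≥ 0}` lies in `P^{≥ p+1, ≥ q}` (`bigradedSub_inf_le`). By
  freeness of `P` this is a statement on ideals of `ΛZ ⊗ ΛW`, where wordlength in `Z` is a
  grading. The latter comes from the homomorphism to `(ΛZ ⊗ ΛW)[t]` that multiplies `Z` by `t`,
  which exists by the universal property of `ΛV` (`CDGA.IsRelativeSullivan.exists_coaction`).

With `r j = (m - j) * c + n + 1` for `j ≤ m` the step is possible as soon as `c ≥ n + 1` and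
`δ * c ≥ n + 2`, that is, for `c = n + 2` in general and `c = n + 1` in the minimal case. A
cocycle of wordlength at least `m * c + n + 1` in `V` lies in the sum for `p = 0`, which bounds
`e_{ΛV}(P)` by `m * c + n` (`toomer_total_sup_le`).
-/

namespace RelToomer

/-! ### Graded subspaces of a CDGA -/

namespace CDGA

variable {k A : Type*} [Field k] [Ring A] [Algebra k A] (C : CDGA k A)

/-- The sign involution `a ↦ (-1)^{|a|} a` of a CDGA. -/
noncomputable def sign : A →ₗ[k] A := C.exists_sign.choose

theorem sign_apply {n : ℕ} {a : A} (ha : a ∈ C.gr n) : C.sign a = (-1) ^ n * a :=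
  C.exists_sign.choose_spec.1 n a ha

theorem sign_mul (a b : A) : C.sign (a * b) = C.sign a * C.sign b :=
  C.exists_sign.choose_spec.2.1 a b

theorem d_mul (a b : A) : C.d (a * b) = C.d a * b + C.sign a * C.d b :=
  C.exists_sign.choose_spec.2.2 a b

theorem sign_one : C.sign 1 = 1 := by
  let _ := C.graded
  simpa using C.sign_apply (n := 0) (a := 1) SetLike.GradedOne.one_mem

theorem d_one : C.d 1 = 0 := by
  have := C.d_mul 1 1
  rw [sign_one] at this
  simpa using this

theorem d_eq_zero_of_mem_one {x : A} (hx : x ∈ (1 : Submodule k A)) : C.d x = 0 := by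
  obtain ⟨r, rfl⟩ := Submodule.mem_one.mp hx
  rw [Algebra.algebraMap_eq_smul_one, map_smul, d_one, smul_zero]

theorem neg_one_pow_mul_mem (n : ℕ) {S : Submodule k A} {a : A} (ha : a ∈ S) :
    (-1) ^ n * a ∈ S := by
  rcases neg_one_pow_eq_or A n with h | h <;> simp [h, ha]

theorem sign_mem_total {V : ℕ → Submodule k A} (hV : ∀ n, V n ≤ C.gr n) {x : A}
    (hx : x ∈ total V) : C.sign x ∈ total V := by
  induction hx using Submodule.iSup_induction' with
  | zero => simp
  | add a b _ _ ha hb => rw [map_add]; exact add_mem ha hb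
  | mem n x hx =>
    rw [C.sign_apply (hV n hx)]
    exact neg_one_pow_mul_mem n (le_iSup V n hx)

theorem sign_mem_mul {S T : Submodule k A} (hS : ∀ x ∈ S, C.sign x ∈ S)
    (hT : ∀ x ∈ T, C.sign x ∈ T) : ∀ x ∈ S * T, C.sign x ∈ S * T := by
  intro x hx
  induction hx using Submodule.mul_induction_on' with
  | add a _ b _ ha hb => rw [map_add]; exact add_mem ha hb
  | mem_mul_mem a ha b hb => rw [sign_mul]; exact Submodule.mul_mem_mul (hS a ha) (hT b hb)

theorem sign_mem_pow {S : Submodule k A} (hS : ∀ x ∈ S, C.sign x ∈ S) (p : ℕ) :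
    ∀ x ∈ S ^ p, C.sign x ∈ S ^ p := by
  induction p with
  | zero =>
    intro x hx
    rw [pow_zero] at hx ⊢
    obtain ⟨r, rfl⟩ := Submodule.mem_one.mp hx
    rw [Algebra.algebraMap_eq_smul_one, map_smul, sign_one]
    exact Submodule.smul_mem _ _ (Submodule.one_le.mp le_rfl)
  | succ p ih => rw [pow_succ]; exact C.sign_mem_mul ih hS

/-- The Leibniz rule for products of subspaces. -/
theorem d_mem_of_mem_mul {S T I J K : Submodule k A} (hS : ∀ x ∈ S, C.sign x ∈ S)
    (hI : ∀ x ∈ S, C.d x ∈ I) (hJ : ∀ x ∈ T, C.d x ∈ J) (hIK : I * T ≤ K) (hJK : S * J ≤ K) :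
    ∀ x ∈ S * T, C.d x ∈ K := by
  intro x hx
  induction hx using Submodule.mul_induction_on' with
  | add a _ b _ ha hb => rw [map_add]; exact add_mem ha hb
  | mem_mul_mem a ha b hb =>
    rw [d_mul]
    exact add_mem (hIK (Submodule.mul_mem_mul (hI a ha) hb))
      (hJK (Submodule.mul_mem_mul (hS a ha) (hJ b hb)))

/-- Graded subspaces of a CDGA commute as subspaces. -/
theorem commute_total {V V' : ℕ → Submodule k A} (hV : ∀ n, V n ≤ C.gr n)
    (hV' : ∀ n, V' n ≤ C.gr n) : Commute (total V) (total V') := by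
  have key : ∀ {V V' : ℕ → Submodule k A}, (∀ n, V n ≤ C.gr n) → (∀ n, V' n ≤ C.gr n) →
      total V * total V' ≤ total V' * total V := by
    intro V V' hV hV'
    unfold total
    simp only [Submodule.iSup_mul, Submodule.mul_iSup]
    refine iSup_le fun i => iSup_le fun j => Submodule.mul_le.mpr fun x hx y hy => ?_
    rw [C.gcomm _ _ x (hV _ hx) y (hV' _ hy)]
    exact neg_one_pow_mul_mem _ (Submodule.mem_iSup_of_mem _ (Submodule.mem_iSup_of_mem _
      (Submodule.mul_mem_mul hy hx)))
  exact le_antisymm (key hV hV') (key hV' hV)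

theorem commute_top {V : ℕ → Submodule k A} (hV : ∀ n, V n ≤ C.gr n) :
    Commute (⊤ : Submodule k A) (total V) := C.top_mul_total V hV

end CDGA

section Ideal

variable {k A : Type*} [Field k] [Ring A] [Algebra k A]

/-- The ideal `Λ^{≥ p} Z ⊗ Λ^{≥ q} W = A · Z^p · W^q` of `A = ΛZ ⊗ ΛW`. -/
def bigradedIdeal (Z W : ℕ → Submodule k A) (p q : ℕ) : Submodule k A :=
  ⊤ * (total Z ^ p * total W ^ q)

theorem top_mul_top : (⊤ : Submodule k A) * ⊤ = ⊤ := by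
  refine top_le_iff.mp fun x _ => ?_
  simpa using Submodule.mul_mem_mul (Submodule.mem_top : x ∈ (⊤ : Submodule k A))
    (Submodule.mem_top : (1 : A) ∈ _)

variable {Z W : ℕ → Submodule k A}

theorem top_mul_bigradedIdeal (p q : ℕ) :
    (⊤ : Submodule k A) * bigradedIdeal Z W p q = bigradedIdeal Z W p q := by
  rw [bigradedIdeal, ← mul_assoc, top_mul_top]

theorem le_bigradedIdeal (p q : ℕ) : total Z ^ p * total W ^ q ≤ bigradedIdeal Z W p q := by
  intro x hx
  simpa [bigradedIdeal] using
    Submodule.mul_mem_mul (Submodule.mem_top : (1 : A) ∈ (⊤ : Submodule k A)) hx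

variable (C : CDGA k A)

theorem total_pow_mul_bigradedIdeal (hZ : ∀ n, Z n ≤ C.gr n) (hW : ∀ n, W n ≤ C.gr n) (p q s : ℕ) :
    total W ^ s * bigradedIdeal Z W p q = bigradedIdeal Z W p (q + s) := by
  have h1 : Commute (total W ^ s) (⊤ : Submodule k A) := ((C.commute_top hW).pow_right s).symm
  have h2 : Commute (total W ^ s) (total Z ^ p) := (C.commute_total hW hZ).pow_pow s p
  rw [bigradedIdeal, bigradedIdeal, ← mul_assoc, h1.eq, mul_assoc, ← mul_assoc (total W ^ s),
    h2.eq, mul_assoc, ← pow_add, add_comm s]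

theorem base_pow_mul_bigradedIdeal (hZ : ∀ n, Z n ≤ C.gr n) (p q s : ℕ) :
    total Z ^ s * bigradedIdeal Z W p q = bigradedIdeal Z W (p + s) q := by
  have h1 : Commute (total Z ^ s) (⊤ : Submodule k A) := ((C.commute_top hZ).pow_right s).symm
  rw [bigradedIdeal, bigradedIdeal, ← mul_assoc, h1.eq, mul_assoc, ← mul_assoc (total Z ^ s),
    ← pow_add, add_comm s]

theorem bigradedIdeal_mul_top (hZ : ∀ n, Z n ≤ C.gr n) (hW : ∀ n, W n ≤ C.gr n) (p q : ℕ) :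
    bigradedIdeal Z W p q * ⊤ = bigradedIdeal Z W p q := by
  have h1 : Commute (total W ^ q) (⊤ : Submodule k A) := ((C.commute_top hW).pow_right q).symm
  have h2 : Commute (total Z ^ p) (⊤ : Submodule k A) := ((C.commute_top hZ).pow_right p).symm
  rw [bigradedIdeal, mul_assoc, (h2.mul_left h1).eq, ← mul_assoc, top_mul_top]

theorem bigradedIdeal_anti (hZ : ∀ n, Z n ≤ C.gr n) (hW : ∀ n, W n ≤ C.gr n)
    {p p' q q' : ℕ} (hp : p' ≤ p) (hq : q' ≤ q) :
    bigradedIdeal Z W p q ≤ bigradedIdeal Z W p' q' := by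
  obtain ⟨i, rfl⟩ := Nat.exists_eq_add_of_le hp
  obtain ⟨j, rfl⟩ := Nat.exists_eq_add_of_le hq
  rw [← base_pow_mul_bigradedIdeal C hZ, ← total_pow_mul_bigradedIdeal C hZ hW]
  calc total Z ^ i * (total W ^ j * bigradedIdeal Z W p' q')
      ≤ ⊤ * (⊤ * bigradedIdeal Z W p' q') :=
        mul_le_mul' le_top (mul_le_mul' le_top le_rfl)
    _ = _ := by rw [top_mul_bigradedIdeal, top_mul_bigradedIdeal]

theorem bigradedIdeal_zero_right (p : ℕ) : bigradedIdeal Z W p 0 = ⊤ * total Z ^ p := by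
  simp [bigradedIdeal]

theorem bigradedIdeal_zero_left (q : ℕ) : bigradedIdeal Z W 0 q = ⊤ * total W ^ q := by
  simp [bigradedIdeal]

/-- The elements of word length at least `s` in `ΛV = ΛZ ⊗ ΛW` lie in the sum of the ideals
`Λ^{≥ j} Z ⊗ Λ^{≥ s - j} W`. -/
theorem total_sup_pow_le (hZ : ∀ n, Z n ≤ C.gr n) (hW : ∀ n, W n ≤ C.gr n) (s : ℕ) :
    (total Z ⊔ total W) ^ s ≤ ⨆ j : ℕ, bigradedIdeal Z W j (s - j) := by
  have hc := C.commute_total hZ hW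
  have key : (total Z ⊔ total W) ^ s ≤
      ⨆ j : Fin (s + 1), total Z ^ (j : ℕ) * total W ^ (s - j) := by
    induction s with
    | zero => exact le_iSup_of_le 0 (by simp)
    | succ s ih =>
      rw [pow_succ']
      refine (mul_le_mul' le_rfl ih).trans ?_
      rw [Submodule.mul_iSup]
      refine iSup_le fun j => ?_
      rw [Submodule.sup_mul]
      refine sup_le ?_ ?_
      · refine le_iSup_of_le j.succ (le_of_eq ?_)
        rw [← mul_assoc, ← pow_succ', Fin.val_succ, Nat.add_sub_add_right]
      · refine le_iSup_of_le j.castSucc (le_of_eq ?_)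
        rw [← mul_assoc, (hc.symm.pow_right _).eq, mul_assoc, ← pow_succ', Fin.val_castSucc,
          Nat.sub_add_comm (by omega)]
  exact key.trans (iSup_le fun j => le_iSup_of_le (j : ℕ) (le_bigradedIdeal _ _))

end Ideal

/-! ### The wordlength in the base as a grading -/

section Coaction

open Polynomial

variable {k A : Type*} [Field k] [Ring A] [Algebra k A]

/-- Two disjoint subspaces are separated by a linear endomorphism. -/
theorem exists_linearMap_eq_self_eq_zero {S T : Submodule k A} (h : Disjoint S T) :
    ∃ f : A →ₗ[k] A, (∀ x ∈ S, f x = x) ∧ ∀ x ∈ T, f x = 0 := by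
  obtain ⟨S', hS, hS'⟩ := h.exists_isCompl
  refine ⟨S'.subtype ∘ₗ S'.projectionOnto T hS', fun x hx => ?_, fun x hx => ?_⟩
  · exact congrArg Subtype.val (Submodule.projectionOnto_apply_left hS' ⟨x, hS hx⟩)
  · simpa using hx

/-- The universal property of the free graded commutative algebra `A = ΛV`. -/
theorem CDGA.IsFreeOn.exists_lift {C : CDGA k A} {V : ℕ → Submodule k A} (h : C.IsFreeOn V)
    {B : Type*} [Ring B] [Algebra k B] (g : ∀ n, V n →ₗ[k] B)
    (hg : ∀ i j (x : V i) (y : V j), g i x * g j y = (-1) ^ (i * j) * (g j y * g i x)) :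
    ∃ ψ : A →ₐ[k] B, ∀ n (v : V n), ψ v = g n v := by
  obtain ⟨hV, hbij⟩ := h
  let ψ₀ : FreeGCA k (fun n => V n) →ₐ[k] B :=
    RingQuot.liftAlgHom k ⟨TensorAlgebra.lift k (DirectSum.toModule k ℕ B g), by
      rintro _ _ ⟨i, j, x, y⟩
      simpa using hg i j x y⟩
  have h₀ : ∀ n (v : V n), ψ₀ (RingQuot.mkAlgHom k (FreeRel k fun n => V n)
      (TensorAlgebra.ι k (DirectSum.lof k ℕ (fun n => V n) n v))) = g n v := by
    intro n v
    simp [ψ₀]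
  have h₁ : ∀ n (v : V n), C.canonicalMap V hV (RingQuot.mkAlgHom k (FreeRel k fun n => V n)
      (TensorAlgebra.ι k (DirectSum.lof k ℕ (fun n => V n) n v))) = v := by
    intro n v
    simp [CDGA.canonicalMap, tensorMap]
  refine ⟨ψ₀.comp (AlgEquiv.ofBijective (C.canonicalMap V hV) hbij).symm.toAlgHom, fun n v => ?_⟩
  rw [← h₀ n v]
  refine congrArg ψ₀ ?_
  refine (AlgEquiv.symm_apply_eq (AlgEquiv.ofBijective (C.canonicalMap V hV) hbij)).mpr ?_
  exact (h₁ n v).symm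

/-- The algebra homomorphism `ΛZ ⊗ ΛW → (ΛZ ⊗ ΛW)[t]` that multiplies `Z` by `t` and fixes `W`. It
encodes the grading of `ΛZ ⊗ ΛW` by wordlength in `Z`. -/
theorem CDGA.IsRelativeSullivan.exists_coaction {C : CDGA k A} {Z W : ℕ → Submodule k A}
    (h : C.IsRelativeSullivan Z W) :
    ∃ ψ : A →ₐ[k] A[X], (∀ z ∈ total Z, ψ z = Polynomial.C z * X) ∧
      ∀ w ∈ total W, ψ w = Polynomial.C w := by
  choose f hfZ hfW using fun n => exists_linearMap_eq_self_eq_zero (h.disjoint n)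
  -- on `V^n` the homomorphism is `v ↦ f v * t + (v - f v)`
  let c : A →ₗ[k] A[X] := (Polynomial.CAlgHom (R := k) (A := A)).toLinearMap
  let g : ∀ n, ↥(Z n ⊔ W n) →ₗ[k] A[X] := fun n =>
    (LinearMap.mulRight k X ∘ₗ c ∘ₗ f n + c ∘ₗ (LinearMap.id - f n)) ∘ₗ (Z n ⊔ W n).subtype
  have hg : ∀ n (v : ↥(Z n ⊔ W n)),
      g n v = Polynomial.C (f n v) * X + Polynomial.C ((v : A) - f n v) := by
    intro n v; simp [g, c]
  have hf : ∀ n, ∀ v ∈ Z n ⊔ W n, f n v ∈ C.gr n := by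
    intro n v hv
    obtain ⟨z, hz, w, hw, rfl⟩ := Submodule.mem_sup.mp hv
    rw [map_add, hfZ n z hz, hfW n w hw, add_zero]
    exact h.le_gr n (Submodule.mem_sup_left hz)
  have hcomm : ∀ i j : ℕ, ∀ a ∈ C.gr i, ∀ b ∈ C.gr j,
      (Polynomial.C a * Polynomial.C b : A[X]) =
        (-1) ^ (i * j) * (Polynomial.C b * Polynomial.C a) := by
    intro i j a ha b hb
    rw [← Polynomial.C_mul, C.gcomm i j a ha b hb]
    simp
  obtain ⟨ψ, hψ⟩ := h.free.exists_lift g (by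
    intro i j x y
    have hx := hf i x x.2
    have hy := hf j y y.2
    have hx' := sub_mem (h.le_gr i x.2) hx
    have hy' := sub_mem (h.le_gr j y.2) hy
    have hX : ∀ a b : A[X], a * X * b = a * b * X := fun a b => by
      rw [mul_assoc, X_mul, mul_assoc]
    rw [hg, hg]
    simp only [mul_add, add_mul, hX, ← mul_assoc]
    rw [hcomm i j _ hx _ hy, hcomm i j _ hx _ hy', hcomm i j _ hx' _ hy, hcomm i j _ hx' _ hy']
    simp only [mul_assoc]
    abel)
  refine ⟨ψ, fun z hz => ?_, fun w hw => ?_⟩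
  · induction hz using Submodule.iSup_induction' with
    | zero => simp
    | add a b _ _ ha hb => rw [map_add, ha, hb, Polynomial.C_add, add_mul]
    | mem n x hx =>
      rw [hψ n ⟨x, Submodule.mem_sup_left hx⟩, hg]
      simp [hfZ n x hx]
  · induction hw using Submodule.iSup_induction' with
    | zero => simp
    | add a b _ _ ha hb => rw [map_add, ha, hb, Polynomial.C_add]
    | mem n x hx =>
      rw [hψ n ⟨x, Submodule.mem_sup_right hx⟩, hg]
      simp [hfW n x hx]

theorem map_pow_eq_C_mul_X_pow (ψ : A →ₐ[k] A[X]) {S : Submodule k A} (s : ℕ)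
    (hψ : ∀ x ∈ S, ψ x = Polynomial.C x * X ^ s) (p : ℕ) :
    ∀ x ∈ S ^ p, ψ x = Polynomial.C x * X ^ (p * s) := by
  induction p with
  | zero =>
    intro x hx
    obtain ⟨r, rfl⟩ := Submodule.mem_one.mp (by simpa using hx)
    simp
  | succ p ih =>
    intro x hx
    rw [pow_succ] at hx
    induction hx using Submodule.mul_induction_on' with
    | add a _ b _ ha hb => rw [map_add, ha, hb, Polynomial.C_add, ← add_mul]
    | mem_mul_mem a ha b hb =>
      rw [map_mul, ih a ha, hψ b hb, Polynomial.C_mul, add_mul, one_mul, pow_add,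
        mul_assoc, ← mul_assoc (X ^ _), X_pow_mul, mul_assoc, mul_assoc]

end Coaction

section Truncation

variable {k A : Type*} [Field k] [Ring A] [Algebra k A]

theorem adjoin_le_iSup_pow (S : Submodule k A) :
    Subalgebra.toSubmodule (Algebra.adjoin k (S : Set A)) ≤ ⨆ s : ℕ, S ^ s := by
  intro x hx
  rw [Subalgebra.mem_toSubmodule] at hx
  induction hx using Algebra.adjoin_induction with
  | mem x hx => exact Submodule.mem_iSup_of_mem 1 (by simpa using hx)
  | algebraMap r => exact Submodule.mem_iSup_of_mem 0 (by simp)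
  | add x y _ _ h h' => exact add_mem h h'
  | mul x y _ _ h h' =>
    refine (?_ : (⨆ s : ℕ, S ^ s) * (⨆ s : ℕ, S ^ s) ≤ _) (Submodule.mul_mem_mul h h')
    simp only [Submodule.iSup_mul, Submodule.mul_iSup]
    exact iSup_le fun i => iSup_le fun j => le_iSup_of_le (j + i) (by rw [pow_add])

theorem CDGA.IsFreeOn.adjoin_eq_top {C : CDGA k A} {V : ℕ → Submodule k A}
    (h : C.IsFreeOn V) : Algebra.adjoin k (total V : Set A) = ⊤ := by
  obtain ⟨hV, hbij⟩ := h
  refine top_le_iff.mp fun x hx => ?_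
  clear hx
  obtain ⟨y, rfl⟩ := hbij.2 x
  obtain ⟨y, rfl⟩ := RingQuot.mkAlgHom_surjective k _ y
  rw [CDGA.canonicalMap, RingQuot.liftAlgHom_mkAlgHom_apply]
  induction y using TensorAlgebra.induction with
  | algebraMap r => simp
  | add a b ha hb => rw [map_add]; exact add_mem ha hb
  | mul a b ha hb => rw [map_mul]; exact mul_mem ha hb
  | ι v =>
    rw [tensorMap, TensorAlgebra.lift_ι_apply]
    refine Algebra.subset_adjoin ?_
    induction v using DirectSum.induction_on with
    | zero => simp
    | add a b ha hb => rw [map_add]; exact add_mem ha hb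
    | of n v =>
      erw [DirectSum.toModule_lof]
      exact le_iSup V n v.2

namespace CDGA.IsRelativeSullivan

variable {C : CDGA k A} {Z W : ℕ → Submodule k A}

theorem base_le (h : C.IsRelativeSullivan Z W) (n : ℕ) : Z n ≤ C.gr n :=
  le_sup_left.trans (h.le_gr n)

theorem fibre_le (h : C.IsRelativeSullivan Z W) (n : ℕ) : W n ≤ C.gr n :=
  le_sup_right.trans (h.le_gr n)

theorem top_le_iSup (h : C.IsRelativeSullivan Z W) :
    (⊤ : Submodule k A) ≤ ⨆ i : ℕ, ⨆ j : ℕ, total Z ^ i * total W ^ j := by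
  have hc := C.commute_total h.base_le h.fibre_le
  have h1 := adjoin_le_iSup_pow (total fun n => Z n ⊔ W n)
  rw [h.free.adjoin_eq_top, Algebra.top_toSubmodule, total_sup] at h1
  refine h1.trans (iSup_le fun s => ?_)
  induction s with
  | zero => exact le_iSup_of_le 0 (le_iSup_of_le 0 (by simp))
  | succ s ih =>
    rw [pow_succ']
    refine (mul_le_mul' le_rfl ih).trans ?_
    simp only [Submodule.mul_iSup, Submodule.sup_mul]
    refine iSup_le fun i => iSup_le fun j => sup_le ?_ ?_
    · refine le_iSup_of_le (i + 1) (le_iSup_of_le j (le_of_eq ?_))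
      rw [← mul_assoc, ← pow_succ']
    · refine le_iSup_of_le i (le_iSup_of_le (j + 1) (le_of_eq ?_))
      rw [← mul_assoc, (hc.symm.pow_right _).eq, mul_assoc, ← pow_succ']

theorem bigradedIdeal_le_iSup (h : C.IsRelativeSullivan Z W) (p q : ℕ) :
    bigradedIdeal Z W p q ≤ ⨆ i : ℕ, ⨆ j : ℕ, total Z ^ (i + p) * total W ^ (j + q) := by
  have hc := C.commute_total h.base_le h.fibre_le
  refine (mul_le_mul' h.top_le_iSup le_rfl).trans ?_
  simp only [Submodule.iSup_mul]
  refine iSup_mono fun i => iSup_mono fun j => le_of_eq ?_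
  rw [mul_assoc, ← mul_assoc (total W ^ j), (hc.symm.pow_pow j p).eq, mul_assoc, ← pow_add,
    ← mul_assoc, ← pow_add]

/-- The projection of `ΛZ ⊗ ΛW` onto `Λ^{≥ p} Z ⊗ ΛW` along `Λ^{< p} Z ⊗ ΛW`. It respects the
wordlength in `W`. -/
theorem exists_truncation (h : C.IsRelativeSullivan Z W) (p : ℕ) :
    ∃ π : A →ₗ[k] A, (∀ a ∈ bigradedIdeal Z W p 0, π a = a) ∧
      ∀ i q, ∀ a ∈ bigradedIdeal Z W i q, π a ∈ bigradedIdeal Z W p q := by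
  obtain ⟨ψ, hZ, hW⟩ := h.exists_coaction
  have hψ : ∀ i j, ∀ a ∈ total Z ^ i * total W ^ j, ψ a = Polynomial.C a * Polynomial.X ^ i := by
    intro i j a ha
    induction ha using Submodule.mul_induction_on' with
    | add a _ b _ ha hb => rw [map_add, ha, hb, Polynomial.C_add, add_mul]
    | mem_mul_mem a ha b hb =>
      rw [map_mul, map_pow_eq_C_mul_X_pow ψ 1 (by simpa using hZ) i a ha,
        map_pow_eq_C_mul_X_pow ψ 0 (by simpa using hW) j b hb, Polynomial.C_mul, mul_one,
        mul_zero, pow_zero, mul_one, mul_assoc, Polynomial.X_pow_mul, mul_assoc]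
  let coe : ℕ → A →ₗ[k] A := fun i =>
    ((Polynomial.lcoeff A i).restrictScalars k) ∘ₗ ψ.toLinearMap
  -- subtract the components of wordlength less than `p` in `Z`
  let π : A →ₗ[k] A := LinearMap.id - ∑ i ∈ Finset.range p, coe i
  have hπ : ∀ i j, ∀ a ∈ total Z ^ i * total W ^ j, π a = if p ≤ i then a else 0 := by
    intro i j a ha
    have : ∀ l, coe l a = if i = l then a else 0 := by
      intro l
      simp [coe, hψ i j a ha, Polynomial.coeff_X_pow, eq_comm]
    simp only [π, LinearMap.sub_apply, LinearMap.id_apply, LinearMap.sum_apply, this,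
      Finset.sum_ite_eq, Finset.mem_range]
    by_cases hp : p ≤ i
    · simp [hp, hp.not_gt]
    · simp [hp, not_le.mp hp]
  refine ⟨π, fun a ha => ?_, fun i q a ha => ?_⟩
  · replace ha := h.bigradedIdeal_le_iSup p 0 ha
    induction ha using Submodule.iSup_induction' with
    | zero => simp
    | add a b _ _ ha hb => rw [map_add, ha, hb]
    | mem i x hx =>
      induction hx using Submodule.iSup_induction' with
      | zero => simp
      | add a b _ _ ha hb => rw [map_add, ha, hb]
      | mem j x hx => rw [hπ _ _ x hx, if_pos (by omega)]
  · replace ha := h.bigradedIdeal_le_iSup i q ha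
    induction ha using Submodule.iSup_induction' with
    | zero => simp
    | add a b _ _ ha hb => rw [map_add]; exact add_mem ha hb
    | mem s x hx =>
      induction hx using Submodule.iSup_induction' with
      | zero => simp
      | add a b _ _ ha hb => rw [map_add]; exact add_mem ha hb
      | mem j x hx =>
        rw [hπ _ _ x hx]
        split_ifs with hp
        · exact bigradedIdeal_anti C h.base_le h.fibre_le hp (Nat.le_add_left q j)
            (le_bigradedIdeal _ _ hx)
        · exact zero_mem _

end CDGA.IsRelativeSullivan

end Truncation

/-! ### Semifree modules -/

section Semifree

variable {k A P : Type*} [Field k] [Ring A] [Algebra k A] {C : CDGA k A}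
  [AddCommGroup P] [Module k P] [Module A P] [IsScalarTower k A P]

theorem DGModule.IsSemifree.exists_basis {D : DGModule C P} (h : D.IsSemifree) :
    ∃ S : Set P, Nonempty (Module.Basis S A P) := by
  obtain ⟨F, hF0, hF, htop, hS⟩ := h
  choose S hS hli hspan using hS
  let T : ℕ → Set P := fun j => Nat.rec ∅ (fun j T => T ∪ S j) j
  have hT : ∀ j, T (j + 1) = T j ∪ S j := fun j => rfl
  have hTspan : ∀ j, Submodule.span A (T j) = F j := by
    intro j
    induction j with
    | zero => rw [hF0]; exact Submodule.span_empty
    | succ j ih => rw [hT, Submodule.span_union, ih, hspan]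
  have hTli : ∀ j, LinearIndepOn A id (T j) := by
    intro j
    induction j with
    | zero => exact linearIndepOn_empty A id
    | succ j ih =>
      refine LinearIndepOn.union_id_of_quotient (M' := F j) ?_ ih (hli j)
      rw [← hTspan j]
      exact Submodule.subset_span
  have hmono : Monotone T := monotone_nat_of_le_succ fun j => by
    rw [hT]; exact Set.subset_union_left
  have hli' : LinearIndepOn A id (⋃ j, T j) :=
    linearIndepOn_iUnion_of_directed hmono.directed_le hTli
  refine ⟨⋃ j, T j, ⟨Module.Basis.mk hli'.linearIndependent ?_⟩⟩
  have : Set.range (fun x : ↥(⋃ j, T j) => id (x : P)) = ⋃ j, T j := Subtype.range_coe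
  rw [this, Submodule.span_iUnion]
  simp only [hTspan, htop, le_refl]

variable {Z W : ℕ → Submodule k A}

theorem restrictScalars_bigradedSub (p q : ℕ) :
    (bigradedSub P Z W p q).restrictScalars k = bigradedIdeal Z W p q • (⊤ : Submodule k P) := by
  apply le_antisymm
  · intro x hx
    replace hx : x ∈ bigradedSub P Z W p q := hx
    induction hx using Submodule.span_induction with
    | zero => simp
    | add a b _ _ ha hb => exact add_mem ha hb
    | mem x hx => exact Submodule.smul_mono_left (le_bigradedIdeal p q) hx
    | smul a x _ ih =>
      rw [← top_mul_bigradedIdeal, ← smul_eq_mul, Submodule.smul_assoc]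
      exact Submodule.smul_mem_smul trivial ih
  · refine Submodule.smul_le.mpr fun a ha x _ => ?_
    rw [bigradedIdeal] at ha
    induction ha using Submodule.mul_induction_on' with
    | add a _ b _ ha hb => rw [add_smul]; exact add_mem ha hb
    | mem_mul_mem a _ b hb =>
      rw [mul_smul]
      exact (bigradedSub P Z W p q).smul_mem _
        (Submodule.subset_span (Submodule.smul_mem_smul hb trivial))

theorem mem_bigradedSub_iff {p q : ℕ} {x : P} :
    x ∈ bigradedSub P Z W p q ↔ x ∈ bigradedIdeal Z W p q • (⊤ : Submodule k P) := by
  rw [← restrictScalars_bigradedSub]; rfl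

theorem bigradedSub_le (hZ : ∀ n, Z n ≤ C.gr n) (hW : ∀ n, W n ≤ C.gr n)
    {p p' q q' : ℕ} (hp : p' ≤ p) (hq : q' ≤ q) :
    bigradedSub P Z W p q ≤ bigradedSub P Z W p' q' := fun x hx => by
  rw [mem_bigradedSub_iff] at hx ⊢
  exact Submodule.smul_mono_left (bigradedIdeal_anti C hZ hW hp hq) hx

/-- In a semifree module `P^{≥ p, ≥ q} ∩ P^{≥ r, ≥ 0}` is contained in `P^{≥ r, ≥ q}`: this is read
off from the coordinates with respect to a basis, where the wordlength in `Z` is a grading. -/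
theorem bigradedSub_inf_le (h : C.IsRelativeSullivan Z W) {D : DGModule C P} (hP : D.IsSemifree)
    (p q r : ℕ) :
    bigradedSub P Z W p q ⊓ bigradedSub P Z W r 0 ≤ bigradedSub P Z W r q := by
  obtain ⟨S, ⟨b⟩⟩ := hP.exists_basis
  obtain ⟨π, hπ, hπ'⟩ := h.exists_truncation r
  have hcoord : ∀ p q (x : P), x ∈ bigradedSub P Z W p q →
      ∀ i, b.repr x i ∈ bigradedIdeal Z W p q := by
    intro p q x hx i
    rw [mem_bigradedSub_iff] at hx
    induction hx using Submodule.smul_induction_on' with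
    | add a _ b _ ha hb => rw [map_add, Finsupp.add_apply]; exact add_mem ha hb
    | smul a ha y _ =>
      rw [map_smul, Finsupp.smul_apply, smul_eq_mul,
        ← bigradedIdeal_mul_top C h.base_le h.fibre_le]
      exact Submodule.mul_mem_mul ha trivial
  rintro x ⟨hx, hx'⟩
  rw [← b.linearCombination_repr x, Finsupp.linearCombination_apply, Finsupp.sum]
  refine sum_mem fun i _ => ?_
  rw [mem_bigradedSub_iff]
  refine Submodule.smul_mem_smul ?_ trivial
  rw [← hπ _ (hcoord r 0 x hx' i)]
  exact hπ' p q _ (hcoord p q x hx i)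

end Semifree

/-! ### The differential and the bigraded filtration -/

section Differential

variable {k A P : Type*} [Field k] [Ring A] [Algebra k A] {C : CDGA k A}
  [AddCommGroup P] [Module k P] [Module A P] [IsScalarTower k A P] {Z W : ℕ → Submodule k A}

theorem DGModule.d_smul (D : DGModule C P) (a : A) (x : P) :
    D.d (a • x) = C.d a • x + C.sign a • D.d x := by
  induction a using C.induction with
  | h0 => simp
  | hadd a a' h h' => simp only [add_smul, map_add, h, h']; abel
  | hom n a ha => rw [D.leibniz n a ha, C.sign_apply ha, mul_smul]

theorem CDGA.d_mem_top_mul_pow (C : CDGA k A) {V : ℕ → Submodule k A} (hV : ∀ n, V n ≤ C.gr n)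
    (hd : ∀ x ∈ total V, C.d x ∈ ⊤ * total V) (p : ℕ) :
    ∀ x ∈ total V ^ p, C.d x ∈ ⊤ * total V ^ p := by
  induction p with
  | zero =>
    intro x hx
    rw [pow_zero] at hx
    simp [C.d_eq_zero_of_mem_one hx]
  | succ p ih =>
    rw [pow_succ']
    refine C.d_mem_of_mem_mul (fun x => C.sign_mem_total hV) hd ih ?_ ?_
    · rw [mul_assoc]
    · rw [← mul_assoc, ← (C.commute_top hV).eq, mul_assoc]

/-- If `d W` lies in the ideal generated by `W` and `Λ^δ Z`, then `d` maps `Λ^p Z ⊗ Λ^q W` to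
`Λ^{≥ p, ≥ q} + Λ^{≥ p + δ, ≥ q - 1}`: a word in `W` loses at most one letter, at the gain of `δ`
letters in `Z`. -/
theorem CDGA.IsRelativeSullivan.d_mem_bigradedIdeal (h : C.IsRelativeSullivan Z W) {δ : ℕ}
    (hδ : ∀ x ∈ total W, C.d x ∈ ⊤ * total W ⊔ ⊤ * total Z ^ δ) (p q : ℕ) :
    ∀ x ∈ total Z ^ p * total W ^ q,
      C.d x ∈ bigradedIdeal Z W p q ⊔ bigradedIdeal Z W (p + δ) (q - 1) := by
  have hZ := h.base_le
  have hW := h.fibre_le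
  have hdW : ∀ q, ∀ x ∈ total W ^ q,
      C.d x ∈ bigradedIdeal Z W 0 q ⊔ bigradedIdeal Z W δ (q - 1) := by
    intro q
    induction q with
    | zero =>
      intro x hx
      rw [pow_zero] at hx
      simp [C.d_eq_zero_of_mem_one hx]
    | succ q ih =>
      intro x hx
      rcases Nat.eq_zero_or_pos q with rfl | hq
      · rw [zero_add, pow_one] at hx
        simpa [bigradedIdeal] using hδ x hx
      · rw [pow_succ'] at hx
        refine C.d_mem_of_mem_mul (fun x => C.sign_mem_total hW) hδ ih ?_ ?_ x hx
        · rw [Submodule.sup_mul, Nat.add_sub_cancel, bigradedIdeal_zero_left, pow_succ',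
            mul_assoc, mul_assoc]
          rfl
        · have h1 := total_pow_mul_bigradedIdeal C hZ hW 0 q 1
          have h2 := total_pow_mul_bigradedIdeal C hZ hW δ (q - 1) 1
          rw [pow_one] at h1 h2
          rw [Submodule.mul_sup, h1, h2, Nat.sub_add_cancel hq, Nat.add_sub_cancel]
  refine C.d_mem_of_mem_mul (C.sign_mem_pow (fun x => C.sign_mem_total hZ) p)
    (C.d_mem_top_mul_pow hZ h.d_base p) (hdW q) ?_ ?_
  · rw [mul_assoc]
    exact le_sup_left
  · rw [Submodule.mul_sup, base_pow_mul_bigradedIdeal C hZ, base_pow_mul_bigradedIdeal C hZ,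
      zero_add, add_comm δ]

theorem DGModule.d_mem_bigradedSub_sup (D : DGModule C P) (h : C.IsRelativeSullivan Z W) {δ : ℕ}
    (hδ : ∀ x ∈ total W, C.d x ∈ ⊤ * total W ⊔ ⊤ * total Z ^ δ) (p q : ℕ) :
    ∀ x ∈ bigradedSub P Z W p q,
      D.d x ∈ bigradedSub P Z W p q ⊔ bigradedSub P Z W (p + δ) (q - 1) := by
  intro x hx
  induction hx using Submodule.span_induction with
  | zero => simp
  | add a b _ _ ha hb => rw [map_add]; exact add_mem ha hb
  | smul a y hy ih =>
    rw [D.d_smul]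
    exact add_mem (Submodule.smul_mem _ _ (Submodule.mem_sup_left hy)) (Submodule.smul_mem _ _ ih)
  | mem x hx =>
    induction hx using Submodule.smul_induction_on' with
    | add a _ b _ ha hb => rw [map_add]; exact add_mem ha hb
    | smul c hc y _ =>
      rw [D.d_smul]
      have hs := C.sign_mem_mul (C.sign_mem_pow (fun x => C.sign_mem_total h.base_le) p)
        (C.sign_mem_pow (fun x => C.sign_mem_total h.fibre_le) q) c hc
      refine add_mem ?_ (Submodule.mem_sup_left
        (Submodule.subset_span (Submodule.smul_mem_smul hs trivial)))
      obtain ⟨a, ha, b, hb, hab⟩ := Submodule.mem_sup.mp (h.d_mem_bigradedIdeal hδ p q c hc)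
      rw [← hab, add_smul]
      exact Submodule.add_mem_sup
        (mem_bigradedSub_iff.mpr (Submodule.smul_mem_smul ha trivial))
        (mem_bigradedSub_iff.mpr (Submodule.smul_mem_smul hb trivial))

theorem CDGA.IsRelativeSullivan.d_mem_top_mul_total (h : C.IsRelativeSullivan Z W) :
    ∀ x ∈ total (fun i => Z i ⊔ W i), C.d x ∈ ⊤ * total fun i => Z i ⊔ W i := by
  intro x hx
  rw [total_sup] at hx ⊢
  obtain ⟨z, hz, w, hw, rfl⟩ := Submodule.mem_sup.mp hx
  rw [map_add, Submodule.mul_sup]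
  refine add_mem (Submodule.mem_sup_left (h.d_base z hz)) ?_
  rw [sup_comm]
  exact h.d_fibre w hw

theorem DGModule.d_mem_pow_smul (D : DGModule C P) {V : ℕ → Submodule k A}
    (hV : ∀ n, V n ≤ C.gr n) (hd : ∀ x ∈ total V, C.d x ∈ ⊤ * total V) (s : ℕ) :
    ∀ x ∈ total V ^ s • (⊤ : Submodule k P), D.d x ∈ total V ^ s • (⊤ : Submodule k P) := by
  intro x hx
  induction hx using Submodule.smul_induction_on' with
  | add a _ b _ ha hb => rw [map_add]; exact add_mem ha hb
  | smul c hc y _ =>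
    rw [D.d_smul]
    refine add_mem ?_ (Submodule.smul_mem_smul
      (C.sign_mem_pow (fun x => C.sign_mem_total hV) s c hc) trivial)
    have h1 := C.d_mem_top_mul_pow hV hd s c hc
    rw [((C.commute_top hV).pow_right s).eq] at h1
    have h2 := Submodule.smul_mem_smul h1 (Submodule.mem_top : y ∈ (⊤ : Submodule k P))
    rw [← smul_eq_mul, Submodule.smul_assoc] at h2
    exact Submodule.smul_mono le_rfl le_top h2

end Differential

/-! ### Minimality -/

section Minimal

variable {k A : Type*} [Field k] [Ring A] [Algebra k A] {C : CDGA k A}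

/-- The ideal generated by a graded subspace is homogeneous. -/
theorem CDGA.decompose_mem_top_mul (C : CDGA k A) {S : Submodule k A}
    (hS : S ≤ ⨆ i, S ⊓ C.gr i) [GradedAlgebra C.gr] {x : A} (hx : x ∈ (⊤ : Submodule k A) * S)
    (n : ℕ) : ((DirectSum.decompose C.gr x n : C.gr n) : A) ∈ (⊤ : Submodule k A) * S := by
  replace hx := mul_le_mul' (le_refl (⊤ : Submodule k A)) hS hx
  rw [Submodule.mul_iSup] at hx
  induction hx using Submodule.iSup_induction' with
  | zero => simp
  | add a b _ _ ha hb =>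
    rw [DirectSum.decompose_add, DirectSum.add_apply]
    exact add_mem ha hb
  | mem j y hy =>
    induction hy using Submodule.mul_induction_on' with
    | add a _ b _ ha hb =>
      rw [DirectSum.decompose_add, DirectSum.add_apply]
      exact add_mem ha hb
    | mem_mul_mem a _ z hz =>
      by_cases hj : j ≤ n
      · rw [DirectSum.coe_decompose_mul_of_right_mem_of_le C.gr hz.2 hj]
        exact Submodule.mul_mem_mul trivial hz.1
      · rw [DirectSum.coe_decompose_mul_of_right_mem_of_not_le C.gr hz.2 hj]
        exact zero_mem _

/-- In a minimal Sullivan algebra `d V ⊆ Λ^{≥ 2} V`: for `v ∈ V^n` the element `d v` has degree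
`n + 1`, while the part of wordlength at most one of `ΛV^{≤ n}` has degrees at most `n`. -/
theorem CDGA.IsMinimalSullivan.d_mem {V : ℕ → Submodule k A} (h : C.IsMinimalSullivan V) :
    ∀ x ∈ total V, C.d x ∈ ⊤ * total V ^ 2 := by
  have hV := h.free.1
  let _ := C.graded
  refine CDGA.IsRelativeSullivan.d_total V hV _ fun n x hx hdx => ?_
  let U : Submodule k A := ⨆ i : ℕ, ⨆ _ : i ≤ n, V i
  have hU : U ≤ total V := iSup_mono fun i => iSup_const_le
  have hadj : Subalgebra.toSubmodule (Algebra.adjoin k (⋃ i ≤ n, (V i : Set A))) ≤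
      (1 ⊔ U) ⊔ ⊤ * total V ^ 2 := by
    have h1 : Algebra.adjoin k (⋃ i ≤ n, (V i : Set A)) ≤ Algebra.adjoin k (U : Set A) :=
      Algebra.adjoin_mono (Set.iUnion₂_subset fun i hi =>
        (le_iSup₂ (f := fun (i : ℕ) (_ : i ≤ n) => V i) i hi))
    refine (show _ ≤ Subalgebra.toSubmodule (Algebra.adjoin k (U : Set A)) from h1).trans
      ((adjoin_le_iSup_pow U).trans (iSup_le fun s => ?_))
    match s with
    | 0 => rw [pow_zero]; exact le_sup_left.trans le_sup_left
    | 1 => rw [pow_one]; exact le_sup_right.trans le_sup_left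
    | s + 2 =>
      rw [pow_add]
      exact (mul_le_mul' le_top (pow_le_pow_left' hU 2)).trans le_sup_right
  obtain ⟨y, hy, z, hz, hyz⟩ := Submodule.mem_sup.mp (hadj (h.minimal n x hx))
  have hy0 : ((DirectSum.decompose C.gr y (n + 1) : C.gr (n + 1)) : A) = 0 := by
    obtain ⟨c, hc, u, hu, rfl⟩ := Submodule.mem_sup.mp hy
    have hc0 : c ∈ C.gr 0 := by
      obtain ⟨r, rfl⟩ := Submodule.mem_one.mp hc
      exact SetLike.algebraMap_mem_graded C.gr r
    rw [DirectSum.decompose_add, DirectSum.add_apply, Submodule.coe_add,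
      DirectSum.decompose_of_mem_ne C.gr hc0 (by omega), zero_add]
    clear hy hyz
    induction hu using Submodule.iSup_induction' with
    | zero => simp
    | add a b _ _ ha hb =>
      rw [DirectSum.decompose_add, DirectSum.add_apply, Submodule.coe_add, ha, hb,
        add_zero]
    | mem i u hu =>
      by_cases hi : i ≤ n
      · rw [iSup_pos hi] at hu
        exact DirectSum.decompose_of_mem_ne C.gr (hV i hu) (by omega)
      · rw [iSup_neg hi, Submodule.mem_bot] at hu
        simp [hu]
  have h2 := DirectSum.decompose_of_mem_same C.gr hdx
  rw [← hyz, DirectSum.decompose_add, DirectSum.add_apply, Submodule.coe_add, hy0, zero_add] at h2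
  rw [← hyz, ← h2]
  refine C.decompose_mem_top_mul ?_ hz _
  rw [pow_two]
  unfold total
  simp only [Submodule.iSup_mul, Submodule.mul_iSup]
  refine iSup_le fun i => iSup_le fun j => le_iSup_of_le (j + i) (le_inf ?_ ?_)
  · exact le_iSup_of_le i (le_iSup_of_le j le_rfl)
  · exact Submodule.mul_le.mpr fun a ha b hb =>
      SetLike.GradedMul.mul_mem (hV _ ha) (hV _ hb)

theorem CDGA.IsRelativeSullivan.d_fibre_of_minimal {Z W : ℕ → Submodule k A}
    (h : C.IsRelativeSullivan Z W) (hmin : C.IsMinimalSullivan fun i => Z i ⊔ W i) :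
    ∀ x ∈ total W, C.d x ∈ ⊤ * total W ⊔ ⊤ * total Z ^ 2 := by
  intro x hx
  have h1 := hmin.d_mem x (by rw [total_sup]; exact Submodule.mem_sup_right hx)
  have hc := C.commute_total h.base_le h.fibre_le
  have ht : ∀ S : Submodule k A, ⊤ * (S * total W) ≤ ⊤ * total W := fun S => by
    rw [← mul_assoc]; exact mul_le_mul' le_top le_rfl
  refine (?_ : _ ≤ ⊤ * total W ⊔ ⊤ * total Z ^ 2) h1
  rw [total_sup, pow_two, Submodule.sup_mul]
  simp only [Submodule.mul_sup]
  rw [← hc.eq, ← pow_two (total Z)]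
  exact sup_le (sup_le le_sup_right ((ht _).trans le_sup_left))
    (sup_le ((ht _).trans le_sup_left) ((ht _).trans le_sup_left))

end Minimal

/-! ### The Toomer invariant in terms of cocycles -/

section Toomer

variable {k M : Type*} [Field k] [AddCommGroup M] [Module k M]

theorem ProjectionInjective.exists_d_eq {d : M →ₗ[k] M} {L : Submodule k M}
    (h : ProjectionInjective d L) {x : M} (hx : x ∈ L) (hdx : d x = 0) : ∃ y, d y = x := by
  obtain ⟨hL, hinj⟩ := h
  have h0 : (Submodule.Quotient.mk ⟨x, hdx⟩ : Cohomology d) = 0 := by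
    apply hinj
    rw [map_zero]
    refine (Submodule.Quotient.mk_eq_zero _).mpr ?_
    have : L.mkQ x = 0 := (Submodule.Quotient.mk_eq_zero L).mpr hx
    exact ⟨0, by rw [map_zero]; exact this.symm⟩
  exact (Submodule.Quotient.mk_eq_zero _).mp h0

theorem projectionInjective_of_exists_d_eq {d : M →ₗ[k] M} (hd : ∀ x, d (d x) = 0)
    {L : Submodule k M} (hL : ∀ x ∈ L, d x ∈ L)
    (h : ∀ x ∈ L, d x = 0 → ∃ y, d y = x) : ProjectionInjective d L := by
  refine ⟨hL, (injective_iff_map_eq_zero _).mpr fun c hc => ?_⟩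
  obtain ⟨⟨x, hx⟩, rfl⟩ := Submodule.Quotient.mk_surjective _ c
  obtain ⟨y, hy⟩ := (Submodule.Quotient.mk_eq_zero _).mp hc
  obtain ⟨y, rfl⟩ := L.mkQ_surjective y
  have hxy : x - d y ∈ L := (Submodule.Quotient.eq L).mp hy.symm
  obtain ⟨z, hz⟩ := h _ hxy (by rw [map_sub, hd, sub_zero]; exact hx)
  refine (Submodule.Quotient.mk_eq_zero _).mpr ⟨z + y, ?_⟩
  rw [map_add, hz]
  exact sub_add_cancel x (d y)

variable {A : Type*} [Ring A] [Algebra k A] [Module A M] [IsScalarTower k A M]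

theorem exists_d_eq_of_toomer_le {V : Submodule k A} {d : M →ₗ[k] M} {n : ℕ}
    (h : toomer V d ≤ n) {x : M} (hx : x ∈ V ^ (n + 1) • (⊤ : Submodule k M)) (hdx : d x = 0) :
    ∃ y, d y = x := by
  obtain ⟨i, hi, hin⟩ : ∃ i : ℕ,
      ProjectionInjective d (V ^ (i + 1) • (⊤ : Submodule k M)) ∧ i ≤ n := by
    have h' : toomer V d < ((n + 1 : ℕ) : ℕ∞) :=
      h.trans_lt (Nat.cast_lt.mpr (Nat.lt_succ_self n))
    simp only [toomer, iInf_lt_iff, Nat.cast_lt] at h'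
    obtain ⟨i, hi, hin⟩ := h'
    exact ⟨i, hi, Nat.lt_succ_iff.mp hin⟩
  refine hi.exists_d_eq ?_ hdx
  obtain ⟨j, rfl⟩ := Nat.exists_eq_add_of_le hin
  rw [show i + j + 1 = (i + 1) + j by ring, pow_add, ← smul_eq_mul, Submodule.smul_assoc] at hx
  exact Submodule.smul_mono le_rfl le_top hx

theorem toomer_le {V : Submodule k A} {d : M →ₗ[k] M} (hd : ∀ x, d (d x) = 0) {n : ℕ}
    (hL : ∀ x ∈ V ^ (n + 1) • (⊤ : Submodule k M), d x ∈ V ^ (n + 1) • (⊤ : Submodule k M))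
    (h : ∀ x ∈ V ^ (n + 1) • (⊤ : Submodule k M), d x = 0 → ∃ y, d y = x) : toomer V d ≤ n :=
  iInf₂_le n (projectionInjective_of_exists_d_eq hd hL h)

end Toomer

/-! ### Climbing the filtration by wordlength in the base -/

section Climb

variable {k A P : Type*} [Field k] [Ring A] [Algebra k A] {C : CDGA k A}
  [AddCommGroup P] [Module k P] [Module A P] [IsScalarTower k A P] {Z W : ℕ → Submodule k A}

/-- The hypothesis on the fibre, in terms of elements of `P`: an element of `P^{≥ p, ≥ q+n+1}` that
is a cocycle modulo `P^{≥ p+1, ≥ 0}` is, modulo `P^{≥ p+1, ≥ 0}`, the differential of an element of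
`P^{≥ p, ≥ q}`. -/
theorem exists_sub_d_mem_of_toomer_le (D : DGModule C P) (h : C.IsRelativeSullivan Z W) {n p q : ℕ}
    (hn : toomer (total W) (bigradedDiff D h p q) ≤ n) {u : P}
    (hu : u ∈ bigradedSub P Z W p (q + (n + 1))) (hdu : D.d u ∈ bigradedSub P Z W (p + 1) 0) :
    ∃ y ∈ bigradedSub P Z W p q, u - D.d y ∈ bigradedSub P Z W (p + 1) 0 := by
  have hle : bigradedSub P Z W p (q + (n + 1)) ≤ bigradedSum P Z W p q :=
    (bigradedSub_le h.base_le h.fibre_le le_rfl (Nat.le_add_right q (n + 1))).trans le_sup_left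
  let cls : bigradedSum P Z W p q →ₗ[A] BigradedQuotient P Z W p q := Submodule.mkQ _
  have hcls : cls ⟨u, hle hu⟩ ∈
      total W ^ (n + 1) • (⊤ : Submodule k (BigradedQuotient P Z W p q)) := by
    have hu' := hu
    rw [mem_bigradedSub_iff, ← total_pow_mul_bigradedIdeal C h.base_le h.fibre_le, ← smul_eq_mul,
      Submodule.smul_assoc] at hu'
    have key : ∀ v ∈ total W ^ (n + 1) • bigradedIdeal Z W p q • (⊤ : Submodule k P),
        ∃ hv : v ∈ bigradedSum P Z W p q,
          cls ⟨v, hv⟩ ∈ total W ^ (n + 1) • (⊤ : Submodule k (BigradedQuotient P Z W p q)) := by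
      intro v hv
      induction hv using Submodule.smul_induction_on' with
      | smul a ha y hy =>
        have hy' : y ∈ bigradedSum P Z W p q :=
          Submodule.mem_sup_left (mem_bigradedSub_iff.mpr hy)
        refine ⟨Submodule.smul_mem _ a hy', ?_⟩
        have : cls ⟨a • y, Submodule.smul_mem _ a hy'⟩ = a • cls ⟨y, hy'⟩ :=
          map_smul cls a ⟨y, hy'⟩
        rw [this]
        exact Submodule.smul_mem_smul ha trivial
      | add a _ b _ ha hb =>
        obtain ⟨ha', ha⟩ := ha
        obtain ⟨hb', hb⟩ := hb
        exact ⟨add_mem ha' hb', add_mem ha hb⟩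
    exact (key u hu').2
  have hcoc : bigradedDiff D h p q (cls ⟨u, hle hu⟩) = 0 :=
    (Submodule.Quotient.mk_eq_zero _).mpr hdu
  obtain ⟨y, hy⟩ := exists_d_eq_of_toomer_le hn hcls hcoc
  obtain ⟨⟨y, hy'⟩, rfl⟩ := Submodule.mkQ_surjective _ y
  have hyu : u - D.d y ∈ bigradedSub P Z W (p + 1) 0 :=
    (Submodule.Quotient.eq
      ((bigradedSub P Z W (p + 1) 0).submoduleOf (bigradedSum P Z W p q))).mp hy.symm
  obtain ⟨y₁, hy₁, y₂, hy₂, rfl⟩ := Submodule.mem_sup.mp hy'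
  refine ⟨y₁, hy₁, ?_⟩
  have : u - D.d y₁ = (u - D.d (y₁ + y₂)) + D.d y₂ := by rw [map_add]; abel
  rw [this]
  exact add_mem hyu (d_mem_base D h (p + 1) y₂ hy₂)

/-- The sum of the submodules `P^{≥ j, ≥ r j}` over `j ≥ p`. -/
def tailSum (P : Type*) [AddCommGroup P] [Module k P] [Module A P] [IsScalarTower k A P]
    (Z W : ℕ → Submodule k A) (r : ℕ → ℕ) (p : ℕ) : Submodule A P :=
  ⨆ j : ℕ, bigradedSub P Z W (p + j) (r (p + j))

theorem le_tailSum (r : ℕ → ℕ) {p j : ℕ} (hj : p ≤ j) :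
    bigradedSub P Z W j (r j) ≤ tailSum P Z W r p := by
  obtain ⟨i, rfl⟩ := Nat.exists_eq_add_of_le hj
  exact le_iSup (fun i => bigradedSub P Z W (p + i) (r (p + i))) i

theorem tailSum_eq_sup (r : ℕ → ℕ) (p : ℕ) :
    tailSum P Z W r p = bigradedSub P Z W p (r p) ⊔ tailSum P Z W r (p + 1) := by
  apply le_antisymm
  · refine iSup_le fun j => ?_
    rcases j with _ | j
    · exact le_sup_left
    · exact (le_tailSum r (by omega)).trans le_sup_right
  · exact sup_le (le_tailSum r le_rfl) (iSup_le fun j => le_tailSum r (by omega))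

theorem tailSum_le (h : C.IsRelativeSullivan Z W) (r : ℕ → ℕ) (p : ℕ) :
    tailSum P Z W r p ≤ bigradedSub P Z W p 0 :=
  iSup_le fun j => bigradedSub_le h.base_le h.fibre_le (Nat.le_add_right p j) (Nat.zero_le _)

/-- One step of the climb: a cocycle in the sum of the `P^{≥ j, ≥ r j}` over `j ≥ p` is
cohomologous to a cocycle in the sum over `j > p`. -/
theorem exists_sub_d_mem_tailSum (D : DGModule C P) (h : C.IsRelativeSullivan Z W)
    (hP : D.IsSemifree) {δ : ℕ}
    (hδ : ∀ x ∈ total W, C.d x ∈ ⊤ * total W ⊔ ⊤ * total Z ^ δ) (hδ1 : 1 ≤ δ)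
    {n p q : ℕ} {r : ℕ → ℕ}
    (hn : toomer (total W) (bigradedDiff D h p q) ≤ n)
    (hr : r p = q + (n + 1)) (hr1 : r (p + 1) ≤ q) (hrδ : r (p + δ) ≤ q - 1) {x : P}
    (hx : x ∈ tailSum P Z W r p) (hdx : D.d x = 0) :
    ∃ y, x - D.d y ∈ tailSum P Z W r (p + 1) := by
  rw [tailSum_eq_sup] at hx
  obtain ⟨u, hu, v, hv, rfl⟩ := Submodule.mem_sup.mp hx
  have hv' := tailSum_le h r (p + 1) hv
  have hdu : D.d u ∈ bigradedSub P Z W (p + 1) 0 := by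
    rw [map_add] at hdx
    rw [eq_neg_of_add_eq_zero_left hdx]
    exact neg_mem (d_mem_base D h (p + 1) v hv')
  rw [hr] at hu
  obtain ⟨y, hy, huy⟩ := exists_sub_d_mem_of_toomer_le D h hn hu hdu
  refine ⟨y, ?_⟩
  obtain ⟨a, ha, b, hb, hab⟩ := Submodule.mem_sup.mp (D.d_mem_bigradedSub_sup h hδ p q y hy)
  have hb' : b ∈ tailSum P Z W r (p + 1) :=
    le_tailSum r (by omega) (bigradedSub_le h.base_le h.fibre_le le_rfl hrδ hb)
  have hua : u - a ∈ bigradedSub P Z W (p + 1) q := by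
    -- both bounds hold for `u - a`: the one on `Z` since `u - a = (u - d y) + b`
    refine bigradedSub_inf_le h hP p q (p + 1) ⟨sub_mem ?_ ha, ?_⟩
    · exact bigradedSub_le h.base_le h.fibre_le le_rfl (Nat.le_add_right q (n + 1)) hu
    · have : u - a = (u - D.d y) + b := by rw [← hab]; abel
      rw [this]
      exact add_mem huy (tailSum_le h r (p + 1) hb')
  have : u + v - D.d y = (u - a) + (v - b) := by rw [← hab]; abel
  rw [this]
  exact add_mem (le_tailSum r le_rfl (bigradedSub_le h.base_le h.fibre_le le_rfl hr1 hua))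
    (sub_mem hv hb')

/-- If `c` letters of `W` suffice to pay for every step in the base, then the Toomer invariant over
`ΛV` is at most `m * c + n`. Here `δ` is the number of letters of `Z` that `d` creates when it
removes a letter of `W`; the inequality `n + 2 ≤ δ * c` says that `δ` steps also pay for this loss.
-/
theorem toomer_total_sup_le (D : DGModule C P) (h : C.IsRelativeSullivan Z W)
    (hP : D.IsSemifree) {m n δ c : ℕ} (hm : toomer (total Z) D.d ≤ m)
    (hn : ∀ p q : ℕ, toomer (total W) (bigradedDiff D h p q) ≤ n)
    (hδ : ∀ x ∈ total W, C.d x ∈ ⊤ * total W ⊔ ⊤ * total Z ^ δ) (hδ1 : 1 ≤ δ)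
    (hc : n + 1 ≤ c) (hδc : n + 2 ≤ δ * c) :
    toomer (total fun i => Z i ⊔ W i) D.d ≤ ((m * c + n : ℕ) : ℕ∞) := by
  -- beyond `m` no letters of `W` are needed, as `Λ^{> m} Z · P` is treated by `hm`
  let r : ℕ → ℕ := fun j => if j ≤ m then (m - j) * c + (n + 1) else 0
  have hr : ∀ j, j ≤ m → r j = (m - j) * c + (n + 1) := fun j hj => if_pos hj
  have hr0 : ∀ j, m < j → r j = 0 := fun j hj => if_neg (by omega)
  have hr1 : ∀ j ≤ m, r (j + 1) ≤ (m - j) * c := by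
    intro j hj
    rcases hj.lt_or_eq with hj | rfl
    · obtain ⟨i, rfl⟩ := Nat.exists_eq_add_of_lt hj
      rw [hr _ (by omega), show j + i + 1 - j = (j + i + 1 - (j + 1)) + 1 by omega, add_mul,
        one_mul]
      omega
    · rw [hr0 _ (by omega)]; exact Nat.zero_le _
  have hrδ : ∀ j ≤ m, r (j + δ) ≤ (m - j) * c - 1 := by
    intro j _
    by_cases hj : j + δ ≤ m
    · rw [hr _ hj, show m - j = (m - (j + δ)) + δ by omega, add_mul]
      omega
    · rw [hr0 _ (by omega)]; exact Nat.zero_le _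
  have climb : ∀ p ≤ m + 1, ∀ x ∈ tailSum P Z W r 0, D.d x = 0 →
      ∃ y, x - D.d y ∈ tailSum P Z W r p := by
    intro p
    induction p with
    | zero => exact fun _ x hx _ => ⟨0, by simpa using hx⟩
    | succ p ih =>
      intro hp x hx hdx
      obtain ⟨y, hy⟩ := ih (by omega) x hx hdx
      obtain ⟨y', hy'⟩ := exists_sub_d_mem_tailSum D h hP hδ hδ1 (hn p ((m - p) * c))
        (hr p (by omega)) (hr1 p (by omega)) (hrδ p (by omega)) hy
        (by rw [map_sub, D.d_d, hdx, sub_zero])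
      exact ⟨y + y', by rwa [map_add, ← sub_sub]⟩
  refine toomer_le D.d_d (D.d_mem_pow_smul h.le_gr h.d_mem_top_mul_total _) fun x hx hdx => ?_
  have hx0 : x ∈ tailSum P Z W r 0 := by
    rw [CDGA.IsRelativeSullivan.total_sup] at hx
    have h1 := Submodule.smul_mono_left (total_sup_pow_le C h.base_le h.fibre_le _) hx
    rw [Submodule.iSup_smul] at h1
    refine (iSup_le fun j => ?_ : _ ≤ (tailSum P Z W r 0).restrictScalars k) h1
    rw [← restrictScalars_bigradedSub]
    have : r j ≤ m * c + n + 1 - j := by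
      by_cases hj : j ≤ m
      · obtain ⟨i, rfl⟩ := Nat.exists_eq_add_of_le hj
        rw [hr j hj, Nat.add_sub_cancel_left, add_mul]
        have : j ≤ j * c := Nat.le_mul_of_pos_right j (by omega)
        omega
      · rw [hr0 j (by omega)]; exact Nat.zero_le _
    intro y hy
    exact le_tailSum r (Nat.zero_le j) (bigradedSub_le h.base_le h.fibre_le le_rfl this hy)
  obtain ⟨y, hy⟩ := climb (m + 1) le_rfl x hx0 hdx
  have hy' := mem_bigradedSub_iff.mp (tailSum_le h r (m + 1) hy)
  rw [bigradedIdeal_zero_right, ((C.commute_top h.base_le).pow_right _).eq, ← smul_eq_mul,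
    Submodule.smul_assoc] at hy'
  obtain ⟨z, hz⟩ := exists_d_eq_of_toomer_le hm (Submodule.smul_mono le_rfl le_top hy')
    (by rw [map_sub, D.d_d, hdx, sub_zero])
  exact ⟨z + y, by rw [map_add, hz, sub_add_cancel]⟩

end Climb

end RelToomer

theorem mainTheorem6 {k : Type*} {A : Type*} {P : Type*} [Field k] [CharZero k]
    [Ring A] [Algebra k A] [AddCommGroup P] [Module k P] [Module A P] [IsScalarTower k A P]
    (C : RelToomer.CDGA k A) (Z W : ℕ → Submodule k A) (hA : C.IsRelativeSullivan Z W)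
    (D : RelToomer.DGModule C P) (hP : D.IsSemifree) (m n : ℕ)
    (hm : RelToomer.toomer (RelToomer.total Z) D.d = (m : ℕ∞))
    (hn : ∀ p q : ℕ,
      RelToomer.toomer (RelToomer.total W) (RelToomer.bigradedDiff D hA p q) ≤ (n : ℕ∞)) :
    RelToomer.toomer (RelToomer.total fun i => Z i ⊔ W i) D.d ≤
        (((m + 1) * (n + 2) - 2 : ℕ) : ℕ∞) ∧
      (C.IsMinimalSullivan (fun i => Z i ⊔ W i) →
        RelToomer.toomer (RelToomer.total fun i => Z i ⊔ W i) D.d ≤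
          (((m + 1) * (n + 1) - 1 : ℕ) : ℕ∞)) := by
  constructor
  · rw [show (m + 1) * (n + 2) - 2 = m * (n + 2) + n by rw [add_mul]; omega]
    refine RelToomer.toomer_total_sup_le D hA hP (δ := 1) hm.le hn ?_ le_rfl (by omega) (by omega)
    simpa using hA.d_fibre
  · intro hmin
    rw [show (m + 1) * (n + 1) - 1 = m * (n + 1) + n by rw [add_mul]; omega]
    exact RelToomer.toomer_total_sup_le D hA hP (δ := 2) hm.le hn (hA.d_fibre_of_minimal hmin)
      (by omega) le_rfl (by omega)
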